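/- Let $\mathrm{dist}_{\mathcal H}(p,q)=\operatorname{acosh}\bigl(1+2\frac{\|p-q\|^2}{(1-\|p\|^2)(1-\|q\|^2)}\bigr)$ be the Poincaré metric on the unit disk, and let a point with native polar coordinates $(\phi,r)$ be mapped to the point of the disk with polar coordinates $(\phi,g(r))$, $g(r)=\sqrt{(\cosh r-1)/(\cosh r+1)}$. For $R,\alpha>0$ the random hyperbolic graph on $n$ vertices is obtained by drawing for every vertex, independently, an angle $\phi$ uniformly from $[0,2\pi)$ and a radius $r\in[0,R)$ with density $\alpha\sinh(\alpha r)/(\cosh(\alpha R)-1)$, and joining two different vertices iff their hyperbolic distance is below $R$; let $m$ be its number of edges. Consider the following generator with input $n$, an average degree $\overline k$ and $\alpha>0$. (1) It determines $R>0$ by a binary search, started on an interval $[\mathrm{lo},\mathrm{hi}]$ with $0\le \mathrm{lo}<\mathrm{hi}$ and stopped at a given tolerance or after at most $n$ halvings, for $$\overline k=\tfrac2\pi\xi^2 n\Bigl(e^{-R/2}+e^{-\alpha R}\bigl(\alpha\tfrac R2\bigl(\tfrac\pi4\tfrac1{\alpha^2}-(\pi-1)\tfrac1\alpha+(\pi-2)\bigr)-1\bigr)\Bigr),\qquad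 \xi=\frac{\alpha}{\alpha-1/2}$$ (at $\alpha=1/2$, where $\xi$ is undefined, set $\xi=0$). (2) It draws the $n$ positions as above and inserts them one by one, at $(\phi,g(r))$, into a polar quadtree with fixed leaf capacity $c\ge1$ whose root is responsible for $[0,2\pi)\times[0,g(R))$. When a point is to be inserted into a full leaf, the leaf is split into four children at $\mathrm{mid}_\phi=(\min_\phi+\max_\phi)/2$ and at the native radius $\mathrm{mid}_r=\operatorname{acosh}\bigl((\cosh(\alpha\max_r)+\cosh(\alpha\min_r))/2\bigr)/\alpha$, and its points move to the children. (3) For every vertex $v$ with disk radius $\rho=g(r[v])$, it performs a range query in the quadtree for the Euclidean circle with center $\bigl(\phi[v],\frac{2\rho}{ab+2}\bigr)$ and radius $\sqrt{\bigl(\frac{2\rho}{ab+2}\bigr)^2-\frac{2\rho^2-ab}{ab+2}}$, where $a=\cosh R-1$ and $b=1-\rho^2$. The query starts at the root and descends only into cells that meet the interior of the circle. An edge $(v,w)$ is output for every vertex $w\ne v$ found inside the circle. Arithmetic operations, comparisons, elementary functions, pointer operations and random draws cost $O(1)$ each. **Theorem.** For every leaf capacity $c\ge1$ there are constants $C$ and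 $n_0$, depending only on $c$, such that for all $n\ge n_0$, all $\overline k\in\mathbb R$, all $\alpha>0$ and all search parameters as above, with probability at least $1-1/n$ the generator terminates, outputs exactly the random hyperbolic graph of the drawn positions, and takes at most $C\,(n^{3/2}+m)\log n$ steps. -/

import Mathlib

open MeasureTheory

noncomputable section

namespace RHG

/-! Random hyperbolic graphs -/

/-- Radial coordinate in the Poincaré disk of a point at hyperbolic distance `r` from the origin. -/
def mapToPoincare (r : ℝ) : ℝ := √((Real.cosh r - 1) / (Real.cosh r + 1))

/-- The point of the Poincaré disk with native polar coordinates `(φ, r)`, as a complex number. -/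
def toDisk (p : ℝ × ℝ) : ℂ := (mapToPoincare p.2 : ℂ) * Complex.exp (p.1 * Complex.I)

/-- The Poincaré metric on the unit disk. -/
def hypDist (p q : ℂ) : ℝ :=
  Real.arcosh (1 + 2 * (‖p - q‖ ^ 2 / ((1 - ‖p‖ ^ 2) * (1 - ‖q‖ ^ 2))))

/-- Two different vertices are adjacent iff their hyperbolic distance is below `R`;
`x v = (φ[v], r[v])` is the position of `v` in native polar coordinates. -/
def hyperbolicGraph {n : ℕ} (R : ℝ) (x : Fin n → ℝ × ℝ) : SimpleGraph (Fin n) where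
  Adj v w := v ≠ w ∧ hypDist (toDisk (x v)) (toDisk (x w)) < R
  symm := ⟨fun v w h => ⟨h.1.symm, by
    have h2 := h.2
    unfold hypDist at h2 ⊢
    rwa [norm_sub_rev, mul_comm (1 - ‖toDisk (x w)‖ ^ 2)]⟩⟩
  loopless := ⟨fun _ h => h.1 rfl⟩

/-- The uniform distribution on `[0, 2π)`. -/
def angleLaw : Measure ℝ :=
  (volume.restrict (Set.Ico 0 (2 * Real.pi))).withDensity
    fun _ => ENNReal.ofReal (1 / (2 * Real.pi))

/-- The distribution on `[0, R)` with density `α sinh(α r) / (cosh(α R) - 1)`. -/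
def radialLaw (α R : ℝ) : Measure ℝ :=
  (volume.restrict (Set.Ico 0 R)).withDensity
    fun r => ENNReal.ofReal (α * Real.sinh (α * r) / (Real.cosh (α * R) - 1))

/-- The law of `n` independent vertex positions. -/
def vertexLaw (n : ℕ) (α R : ℝ) : Measure (Fin n → ℝ × ℝ) :=
  Measure.pi fun _ => angleLaw.prod (radialLaw α R)

/-! Step counting. The model is a real RAM: arithmetic, comparisons, elementary functions,
memory and pointer operations and drawing one coordinate cost `O(1)`. Every loop iteration and
every procedure call executes a bounded number of these and is charged explicitly below. -/

/-- A computation with result in `β`: `some (b, t)` if it returns `b` after `t` steps, `none` if it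
was cut off by the bound on the recursion depth (only insertion, which need not terminate when
points coincide, carries such a bound). -/
def Timed (β : Type) : Type := Option (β × ℕ)

/-- The computation returns `b` after exactly `t` steps. -/
def Timed.Returns {β : Type} (c : Timed β) (b : β) (t : ℕ) : Prop := c = some (b, t)

instance : Monad Timed where
  pure b := some (b, 0)
  bind {β γ} (c : Option (β × ℕ)) (f : β → Option (γ × ℕ)) :=
    c.bind fun bs => (f bs.1).map fun ct => (ct.1, bs.2 + ct.2)

/-- Spend `k` steps. -/
def tick (k : ℕ) : Timed Unit := some ((), k)

/-- The recursion bound is exhausted. -/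
def cutoff {β : Type} : Timed β := (none : Option (β × ℕ))

/-! The target radius -/

/-- The approximation of the expected average degree (curvature `-1`) that defines the radius. -/
def expectedDegree (n : ℕ) (α R : ℝ) : ℝ :=
  let ξ := α / (α - 1 / 2)
  2 / Real.pi * ξ ^ 2 * n * (Real.exp (-R / 2) + Real.exp (-α * R) *
    (α * (R / 2) * (Real.pi / 4 * (1 / α) ^ 2 - (Real.pi - 1) * (1 / α) + (Real.pi - 2)) - 1))

/-- Binary search in `[lo, hi]` for the radius with average degree `k`. It stops as soon as the
degree is met up to `ε`, or after `rounds` halvings. It returns the radius and the number of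
evaluations. -/
def targetRadius (n : ℕ) (k α ε : ℝ) : ℕ → ℝ → ℝ → ℝ × ℕ
  | 0, lo, hi => ((lo + hi) / 2, 1)
  | rounds + 1, lo, hi =>
    let mid := (lo + hi) / 2
    let d := expectedDegree n α mid
    if |d - k| ≤ ε then (mid, 1)
    else
      let res := if d < k then targetRadius n k α ε rounds lo mid
        else targetRadius n k α ε rounds mid hi
      (res.1, res.2 + 1)

/-! The polar quadtree -/

/-- A cell of the quadtree. The radial boundaries are kept in native coordinates; the
corresponding boundaries in the Poincaré disk are `minE`, `maxE`, `midE`. -/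
structure Cell where
  minφ : ℝ
  maxφ : ℝ
  minH : ℝ
  maxH : ℝ

namespace Cell

def minE (c : Cell) : ℝ := mapToPoincare c.minH

def maxE (c : Cell) : ℝ := mapToPoincare c.maxH

def midφ (c : Cell) : ℝ := (c.maxφ + c.minφ) / 2

/-- The splitting radius, which halves the probability mass. -/
def midH (α : ℝ) (c : Cell) : ℝ :=
  Real.arcosh ((Real.cosh (α * c.maxH) + Real.cosh (α * c.minH)) / 2) / α

def midE (α : ℝ) (c : Cell) : ℝ := mapToPoincare (c.midH α)

/-- The four children of a cell: the first index selects the angular half (`false` the lower one),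
the second one the radial half. -/
def sub (α : ℝ) (c : Cell) (q : Bool × Bool) : Cell where
  minφ := if q.1 then c.midφ else c.minφ
  maxφ := if q.1 then c.maxφ else c.midφ
  minH := if q.2 then c.midH α else c.minH
  maxH := if q.2 then c.maxH else c.midH α

end Cell

/-- A stored vertex with its polar coordinates `(φ, r)` in the Poincaré disk. -/
structure Item (V : Type) where
  id : V
  φ : ℝ
  r : ℝ

/-- The child of a cell that is responsible for a point of the cell. -/
def Cell.quadrant {V : Type} (α : ℝ) (c : Cell) (p : Item V) : Bool × Bool :=
  (decide (c.midφ ≤ p.φ), decide (c.midE α ≤ p.r))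

/-- A node holds its cell and either a list of points or pointers to four children. -/
inductive QuadTree (V : Type) : Type where
  | leaf (c : Cell) (pts : List (Item V)) : QuadTree V
  | node (c : Cell) (child : Bool × Bool → QuadTree V) : QuadTree V

/-- A leaf becomes an inner node, and every point of the leaf moves one level down. -/
def splitLeaf {V : Type} (α : ℝ) (c : Cell) (pts : List (Item V)) : Timed (QuadTree V) := do
  tick (4 * (pts.length + 1))
  pure (.node c fun q => .leaf (c.sub α q) (pts.filter fun p => c.quadrant α p = q))

/-- Insertion into a quadtree with leaf capacity `cap`. The first argument bounds the recursion
depth. -/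
def insert {V : Type} (α : ℝ) (cap : ℕ) : ℕ → QuadTree V → Item V → Timed (QuadTree V)
  | 0, _, _ => cutoff
  | depth + 1, .leaf c pts, p => do
    tick (pts.length + 1)
    if pts.length < cap then
      pure (.leaf c (p :: pts))
    else do
      let T ← splitLeaf α c pts
      insert α cap depth T p
  | depth + 1, .node c child, p => do
    tick 1
    let q := c.quadrant α p
    let T ← insert α cap depth (child q) p
    pure (.node c (Function.update child q T))

/-! Range queries -/

/-- Euclidean distance of two points given in polar coordinates. -/
def polarDist (φ₁ r₁ φ₂ r₂ : ℝ) : ℝ :=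
  √(r₁ ^ 2 + r₂ ^ 2 - 2 * r₁ * r₂ * Real.cos (φ₁ - φ₂))

/-- A Euclidean circle with center in polar coordinates. -/
structure Circle where
  φ : ℝ
  r : ℝ
  rad : ℝ

/-- The Euclidean circle that is the hyperbolic circle of radius `R` around the point of the
Poincaré disk with polar coordinates `(φ, r)`. -/
def circleToEuclidean (R φ r : ℝ) : Circle :=
  let a := Real.cosh R - 1
  let b := 1 - r ^ 2
  { φ := φ
    r := 2 * r / (a * b + 2)
    rad := √((2 * r / (a * b + 2)) ^ 2 - (2 * r ^ 2 - a * b) / (a * b + 2)) }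

/-- Distance of the center of `Q` from the side of the cell `c` at angle `θ`. -/
def Cell.sideDist (c : Cell) (Q : Circle) (θ : ℝ) : ℝ :=
  polarDist Q.φ Q.r θ (max c.minE (min c.maxE (Q.r * Real.cos (Q.φ - θ))))

/-- Euclidean distance of the center of `Q` from the (closed) cell `c`. -/
def Cell.dist (c : Cell) (Q : Circle) : ℝ :=
  if c.minφ ≤ Q.φ ∧ Q.φ ≤ c.maxφ then |Q.r - max c.minE (min c.maxE Q.r)|
  else min (c.sideDist Q c.minφ) (c.sideDist Q c.maxφ)

/-- Report the points of a leaf that lie in the circle. -/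
def scan {V : Type} (Q : Circle) : List (Item V) → List V → Timed (List V)
  | [], acc => pure acc
  | p :: pts, acc => do
    tick 1
    scan Q pts (if polarDist p.φ p.r Q.φ Q.r < Q.rad then p.id :: acc else acc)

/-- Add the vertices inside the circle `Q` to the output `acc`, descending only into cells that
meet the interior of the circle. -/
def verticesInCircle {V : Type} (Q : Circle) : QuadTree V → List V → Timed (List V)
  | .leaf c pts, acc => do
    tick 1
    if Q.rad ≤ c.dist Q then pure acc else scan Q pts acc
  | .node c child, acc => do
    tick 1
    if Q.rad ≤ c.dist Q then pure acc
    else do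
      let acc ← verticesInCircle Q (child (false, false)) acc
      let acc ← verticesInCircle Q (child (false, true)) acc
      let acc ← verticesInCircle Q (child (true, false)) acc
      verticesInCircle Q (child (true, true)) acc

/-! Graph generation. The graph is output as the list of the pairs `(v, w)` of neighbors. -/

/-- The first loop: draw the position `x v` of every vertex `v` and insert `v`. -/
def insertLoop {V : Type} (α : ℝ) (cap depth : ℕ) (x : V → ℝ × ℝ) :
    List V → QuadTree V → Timed (QuadTree V)
  | [], T => pure T
  | v :: vs, T => do
    tick 1
    let T ← insert α cap depth T ⟨v, (x v).1, mapToPoincare (x v).2⟩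
    insertLoop α cap depth x vs T

/-- Add the pairs `(v, w)` with `w ≠ v` in the list to the output. -/
def addEdges {V : Type} [DecidableEq V] (v : V) : List V → List (V × V) → Timed (List (V × V))
  | [], E => pure E
  | w :: ws, E => do
    tick 1
    addEdges v ws (if w = v then E else (v, w) :: E)

/-- The second loop: find the neighbors of every vertex by a range query. -/
def edgeLoop {V : Type} [DecidableEq V] (R : ℝ) (T : QuadTree V) (x : V → ℝ × ℝ) :
    List V → List (V × V) → Timed (List (V × V))
  | [], E => pure E
  | v :: vs, E => do
    tick 1
    let Q := circleToEuclidean R (x v).1 (mapToPoincare (x v).2)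
    let ws ← verticesInCircle Q T []
    let E ← addEdges v ws E
    edgeLoop R T x vs E

/-- The generator on input `n, k, α`, with search interval `[lo, hi]`, tolerance `ε` and number of
rounds for the target radius, and leaf capacity `cap`. The random draws are `x`, and insertions
are cut off at recursion depth `depth`. -/
def generate (cap : ℕ) (n : ℕ) (k α lo hi ε : ℝ) (rounds : ℕ) (x : Fin n → ℝ × ℝ) (depth : ℕ) :
    Timed (List (Fin n × Fin n)) := do
  let (R, s) := targetRadius n k α ε rounds lo hi
  tick s
  let T ← insertLoop α cap depth x (List.finRange n) (.leaf ⟨0, 2 * Real.pi, 0, R⟩ [])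
  edgeLoop R T x (List.finRange n) []

end RHG

end

/-!
The split radii are the quantiles of the radial density, so the quadtree cells of depth `l` are the
boxes of the `2 ^ l × 2 ^ l` grid that is uniform with respect to the law of a position. Hence a
cell has probability `4⁻ˡ`, and with high probability the positions are pairwise separated at depth
`O(log n)`, which bounds the height of the quadtree.

A query outputs the neighbours of its vertex, because the query circle is the hyperbolic circle of
radius `R` around it. An expanded cell either contains an output vertex or straddles the circle, and
since the circle is star-shaped about the origin it straddles only `O(N)` cells of the `N × N` grid.
With `N ≈ √n` these cells have total probability `O(1 / √n)`, so by a union bound over the sets of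
`O(√n)` vertices they contain only `O(√n)` vertices for every query at once. Thus every query
expands `O(√n + deg)` cells per level, and the sum over all vertices is the claimed bound.
-/

noncomputable section

namespace RHG

/-! ### Circles in polar coordinates -/

lemma mapToPoincare_nonneg (r : ℝ) : 0 ≤ mapToPoincare r := Real.sqrt_nonneg _

lemma mapToPoincare_sq (r : ℝ) :
    mapToPoincare r ^ 2 = (Real.cosh r - 1) / (Real.cosh r + 1) := by
  have := Real.one_le_cosh r
  exact Real.sq_sqrt (div_nonneg (by linarith) (by linarith))

lemma mapToPoincare_sq_lt_one (r : ℝ) : mapToPoincare r ^ 2 < 1 := by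
  have := Real.one_le_cosh r
  rw [mapToPoincare_sq, div_lt_one (by linarith)]
  linarith

lemma continuous_mapToPoincare : Continuous mapToPoincare := by
  unfold mapToPoincare
  refine Continuous.sqrt (Continuous.div (by fun_prop) (by fun_prop) fun r => ?_)
  have := Real.one_le_cosh r
  linarith

lemma strictMonoOn_mapToPoincare : StrictMonoOn mapToPoincare (Set.Ici 0) := by
  intro r hr s hs hrs
  have h := Real.cosh_strictMonoOn hr hs hrs
  have h1 := Real.one_le_cosh r
  refine Real.sqrt_lt_sqrt (div_nonneg (by linarith) (by linarith)) ?_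
  rw [div_lt_div_iff₀ (by linarith) (by linarith)]
  nlinarith

/-- Disk polar coordinates of the point with native polar coordinates `p`. -/
def diskPolar (p : ℝ × ℝ) : ℝ × ℝ := (p.1, mapToPoincare p.2)

lemma polarDist_eq_norm_sub (φ₁ r₁ φ₂ r₂ : ℝ) : polarDist φ₁ r₁ φ₂ r₂ =
    ‖(r₁ : ℂ) * Complex.exp (φ₁ * Complex.I) - r₂ * Complex.exp (φ₂ * Complex.I)‖ := by
  rw [polarDist, Complex.norm_def, Complex.normSq_apply]
  simp only [Complex.sub_re, Complex.sub_im, Complex.re_ofReal_mul, Complex.im_ofReal_mul,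
    Complex.exp_ofReal_mul_I_re, Complex.exp_ofReal_mul_I_im, Real.cos_sub]
  congr 1
  linear_combination -r₁ ^ 2 * Real.sin_sq_add_cos_sq φ₁ - r₂ ^ 2 * Real.sin_sq_add_cos_sq φ₂

lemma polarDist_comm (φ₁ r₁ φ₂ r₂ : ℝ) : polarDist φ₁ r₁ φ₂ r₂ = polarDist φ₂ r₂ φ₁ r₁ := by
  rw [polarDist_eq_norm_sub, polarDist_eq_norm_sub, norm_sub_rev]

lemma polarDist_nonneg (φ₁ r₁ φ₂ r₂ : ℝ) : 0 ≤ polarDist φ₁ r₁ φ₂ r₂ := Real.sqrt_nonneg _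

lemma polarDist_sq (φ₁ r₁ φ₂ r₂ : ℝ) :
    polarDist φ₁ r₁ φ₂ r₂ ^ 2 = r₁ ^ 2 + r₂ ^ 2 - 2 * r₁ * r₂ * Real.cos (φ₁ - φ₂) := by
  refine Real.sq_sqrt ?_
  have h := sq_nonneg (r₁ - r₂ * Real.cos (φ₁ - φ₂))
  have h' := sq_nonneg (r₂ * Real.sin (φ₁ - φ₂))
  linear_combination h + h' + r₂ ^ 2 * Real.sin_sq_add_cos_sq (φ₁ - φ₂)

lemma continuous_polarDist {X : Type*} [TopologicalSpace X] {f₁ g₁ f₂ g₂ : X → ℝ}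
    (hf₁ : Continuous f₁) (hg₁ : Continuous g₁) (hf₂ : Continuous f₂) (hg₂ : Continuous g₂) :
    Continuous fun x => polarDist (f₁ x) (g₁ x) (f₂ x) (g₂ x) := by
  unfold polarDist
  fun_prop

lemma norm_toDisk (p : ℝ × ℝ) : ‖toDisk p‖ = mapToPoincare p.2 := by
  rw [toDisk, norm_mul, Complex.norm_exp_ofReal_mul_I, mul_one, Complex.norm_real,
    Real.norm_of_nonneg (mapToPoincare_nonneg _)]

lemma norm_toDisk_sub (p q : ℝ × ℝ) :
    ‖toDisk p - toDisk q‖ = polarDist p.1 (mapToPoincare p.2) q.1 (mapToPoincare q.2) :=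
  (polarDist_eq_norm_sub _ _ _ _).symm

namespace Circle

/-- The open disk bounded by a circle, as a set of polar coordinates. -/
def interior (Q : Circle) : Set (ℝ × ℝ) := {p | polarDist p.1 p.2 Q.φ Q.r < Q.rad}

/-- The circle is centered at an angle in `[0, 2π)` and encloses the origin. -/
structure Central (Q : Circle) : Prop where
  φ_nonneg : 0 ≤ Q.φ
  φ_lt : Q.φ < 2 * Real.pi
  r_nonneg : 0 ≤ Q.r
  r_lt : Q.r < Q.rad

variable {Q : Circle}

lemma Central.rad_pos (h : Q.Central) : 0 < Q.rad := h.r_nonneg.trans_lt h.r_lt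

lemma mem_interior_iff_sq_lt (h : 0 < Q.rad) (p : ℝ × ℝ) :
    p ∈ Q.interior ↔ p.2 ^ 2 + Q.r ^ 2 - 2 * p.2 * Q.r * Real.cos (p.1 - Q.φ) < Q.rad ^ 2 := by
  rw [← polarDist_sq, sq_lt_sq₀ (polarDist_nonneg _ _ _ _) h.le, interior, Set.mem_ofPred_eq]

/-- Since the origin is inside, so is the segment from it to any interior point. -/
lemma Central.mem_interior_of_le (hQ : Q.Central) {φ r s : ℝ} (h : (φ, s) ∈ Q.interior)
    (hr : 0 ≤ r) (hrs : r ≤ s) : (φ, r) ∈ Q.interior := by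
  rw [mem_interior_iff_sq_lt hQ.rad_pos] at h ⊢
  have horigin : Q.r ^ 2 < Q.rad ^ 2 := pow_lt_pow_left₀ hQ.r_lt hQ.r_nonneg two_ne_zero
  rcases le_total r (2 * Q.r * Real.cos (φ - Q.φ)) with h1 | h1 <;> nlinarith

end Circle

/-- The Euclidean circle with which the neighbors of a vertex at native position `p` are
queried. -/
def queryCircle (R : ℝ) (p : ℝ × ℝ) : Circle := circleToEuclidean R p.1 (mapToPoincare p.2)

section QueryCircle

variable {R : ℝ}

lemma queryCircle_denom_pos (R : ℝ) (p : ℝ × ℝ) :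
    0 < (Real.cosh R - 1) * (1 - mapToPoincare p.2 ^ 2) + 2 := by
  have := mul_nonneg (sub_nonneg.2 (Real.one_le_cosh R))
    (sub_nonneg.2 (mapToPoincare_sq_lt_one p.2).le)
  linarith

lemma continuous_queryCircle_r (R : ℝ) : Continuous fun p => (queryCircle R p).r := by
  have hg := continuous_mapToPoincare
  exact Continuous.div (by fun_prop) (by fun_prop) fun p => (queryCircle_denom_pos R p).ne'

lemma continuous_queryCircle_rad (R : ℝ) : Continuous fun p => (queryCircle R p).rad := by
  have hg := continuous_mapToPoincare
  exact (((continuous_queryCircle_r R).pow 2).sub (Continuous.div (by fun_prop) (by fun_prop)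
    fun p => (queryCircle_denom_pos R p).ne')).sqrt

lemma queryCircle_central {p : ℝ × ℝ} (hφ : p.1 ∈ Set.Ico 0 (2 * Real.pi))
    (hr : p.2 ∈ Set.Ico 0 R) : (queryCircle R p).Central := by
  have hcosh := Real.cosh_strictMonoOn hr.1 (hr.1.trans hr.2.le) hr.2
  have hden := queryCircle_denom_pos R p
  refine ⟨hφ.1, hφ.2, div_nonneg (mul_nonneg two_pos.le (mapToPoincare_nonneg _)) hden.le,
    Real.lt_sqrt_of_sq_lt ?_⟩
  have hneg : (2 * mapToPoincare p.2 ^ 2 - (Real.cosh R - 1) * (1 - mapToPoincare p.2 ^ 2)) /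
      ((Real.cosh R - 1) * (1 - mapToPoincare p.2 ^ 2) + 2) < 0 := by
    refine div_neg_of_neg_of_pos ?_ hden
    have hpos := Real.cosh_pos p.2
    have : 2 * mapToPoincare p.2 ^ 2 - (Real.cosh R - 1) * (1 - mapToPoincare p.2 ^ 2) =
        2 * (Real.cosh p.2 - Real.cosh R) / (Real.cosh p.2 + 1) := by
      rw [mapToPoincare_sq]
      field_simp
      ring
    rw [this]
    exact div_neg_of_neg_of_pos (by linarith) (by linarith)
  simp only [queryCircle, circleToEuclidean]
  linarith

/-- Up to a positive factor, the power of a point with respect to the query circle compares the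
Euclidean distance in `hypDist` with the threshold belonging to `R`. -/
lemma queryCircle_power {p : ℝ × ℝ} (hrad : 0 < (queryCircle R p).rad) (φ s : ℝ) :
    s ^ 2 + (queryCircle R p).r ^ 2 - 2 * s * (queryCircle R p).r *
        Real.cos (φ - (queryCircle R p).φ) - (queryCircle R p).rad ^ 2 =
      (polarDist p.1 (mapToPoincare p.2) φ s ^ 2 -
        (Real.cosh R - 1) / 2 * ((1 - mapToPoincare p.2 ^ 2) * (1 - s ^ 2))) *
        (2 / ((Real.cosh R - 1) * (1 - mapToPoincare p.2 ^ 2) + 2)) := by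
  have hden := queryCircle_denom_pos R p
  have hsq : (queryCircle R p).rad ^ 2 = _ := Real.sq_sqrt (Real.sqrt_pos.1 hrad).le
  rw [hsq, polarDist_comm, polarDist_sq]
  simp only [queryCircle, circleToEuclidean]
  field_simp
  ring

theorem hypDist_lt_iff (hR : 0 < R) {p : ℝ × ℝ} (hrad : 0 < (queryCircle R p).rad)
    (q : ℝ × ℝ) :
    hypDist (toDisk p) (toDisk q) < R ↔ diskPolar q ∈ (queryCircle R p).interior := by
  have hpos := mul_pos (sub_pos.2 (mapToPoincare_sq_lt_one p.2))
    (sub_pos.2 (mapToPoincare_sq_lt_one q.2))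
  have harg : 0 < 1 + 2 * (polarDist p.1 (mapToPoincare p.2) q.1 (mapToPoincare q.2) ^ 2 /
      ((1 - mapToPoincare p.2 ^ 2) * (1 - mapToPoincare q.2 ^ 2))) := by positivity
  rw [Circle.mem_interior_iff_sq_lt hrad, ← sub_neg (b := _ ^ 2), diskPolar, queryCircle_power hrad,
    ← neg_pos, ← neg_mul, mul_pos_iff_of_pos_right (div_pos two_pos (queryCircle_denom_pos R p)),
    neg_pos, sub_neg, hypDist, norm_toDisk_sub, norm_toDisk, norm_toDisk]
  conv_lhs => rw [← Real.arcosh_cosh hR.le]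
  rw [Real.arcosh_lt_arcosh harg (Real.cosh_pos R), ← lt_sub_iff_add_lt',
    ← lt_div_iff₀' two_pos, div_lt_iff₀ hpos]

end QueryCircle

/-! ### Cells and circles -/

lemma cos_le_max_cos {a x b : ℝ} (ha : 0 ≤ a) (hax : a ≤ x) (hxb : x ≤ b)
    (hb : b ≤ 2 * Real.pi) : Real.cos x ≤ max (Real.cos a) (Real.cos b) := by
  rcases le_total x Real.pi with h | h
  · exact le_max_of_le_left (Real.cos_le_cos_of_nonneg_of_le_pi ha h hax)
  · refine le_max_of_le_right ?_
    rw [← Real.cos_two_pi_sub x, ← Real.cos_two_pi_sub b]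
    exact Real.cos_le_cos_of_nonneg_of_le_pi (by linarith) (by linarith) (by linarith)

lemma sq_clamp_sub_le {m M r : ℝ} (hr : r ∈ Set.Icc m M) (s : ℝ) :
    (max m (min M s) - s) ^ 2 ≤ (r - s) ^ 2 := by
  obtain ⟨hmr, hrM⟩ := hr
  rw [sq_le_sq]
  grind

namespace Cell

/-- The points of a cell in native coordinates, half-open as in the tree. -/
def region (c : Cell) : Set (ℝ × ℝ) := Set.Ico c.minφ c.maxφ ×ˢ Set.Ico c.minH c.maxH

/-- The points of a closed cell in disk polar coordinates; this is what `Cell.dist` refers to. -/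
def closedRegion (c : Cell) : Set (ℝ × ℝ) := Set.Icc c.minφ c.maxφ ×ˢ Set.Icc c.minE c.maxE

/-- The closed cell meets the interior of the circle without being contained in it. These are the
cells a query has to subdivide. -/
def Straddles (c : Cell) (Q : Circle) : Prop :=
  (c.closedRegion ∩ Q.interior).Nonempty ∧ ¬ c.closedRegion ⊆ Q.interior

variable {c : Cell} {Q : Circle}

lemma sideDist_le (hQ : 0 ≤ Q.r) {φ θ r : ℝ} (hr0 : 0 ≤ r) (hr : r ∈ Set.Icc c.minE c.maxE)
    (hcos : Real.cos (φ - Q.φ) ≤ Real.cos (θ - Q.φ)) :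
    c.sideDist Q θ ≤ polarDist φ r Q.φ Q.r := by
  have hclamp := sq_clamp_sub_le hr (Q.r * Real.cos (θ - Q.φ))
  rw [sideDist, polarDist_comm, ← Real.cos_neg (Q.φ - θ), neg_sub]
  refine Real.sqrt_le_sqrt ?_
  have := mul_le_mul_of_nonneg_left hcos (mul_nonneg hr0 hQ)
  nlinarith

lemma dist_le (hQ : Q.Central) (hE : 0 ≤ c.minE) (hφ0 : 0 ≤ c.minφ)
    (hφ1 : c.maxφ ≤ 2 * Real.pi) {p : ℝ × ℝ} (hp : p ∈ c.closedRegion) :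
    c.dist Q ≤ polarDist p.1 p.2 Q.φ Q.r := by
  obtain ⟨⟨h1, h2⟩, hr⟩ := hp
  have hr0 : 0 ≤ p.2 := hE.trans hr.1
  have q1 := hQ.φ_nonneg
  have q2 := hQ.φ_lt
  unfold Cell.dist
  split_ifs with hc
  · refine Real.le_sqrt_of_sq_le ?_
    rw [sq_abs]
    have hclamp := sq_clamp_sub_le hr Q.r
    have := mul_le_mul_of_nonneg_left (Real.cos_le_one (p.1 - Q.φ)) (mul_nonneg hr0 hQ.r_nonneg)
    nlinarith
  · have hcos : Real.cos (p.1 - Q.φ) ≤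
        max (Real.cos (c.minφ - Q.φ)) (Real.cos (c.maxφ - Q.φ)) := by
      rw [not_and_or, not_le, not_le] at hc
      rcases hc with hc | hc
      · exact cos_le_max_cos (by linarith) (by linarith) (by linarith) (by linarith)
      · rw [← Real.cos_neg (p.1 - _), ← Real.cos_neg (c.minφ - _), ← Real.cos_neg (c.maxφ - _),
          max_comm]
        exact cos_le_max_cos (by linarith) (by linarith) (by linarith) (by linarith)
    rcases le_max_iff.1 hcos with h | h
    · exact min_le_of_left_le (sideDist_le hQ.r_nonneg hr0 hr h)
    · exact min_le_of_right_le (sideDist_le hQ.r_nonneg hr0 hr h)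

lemma meets_interior_of_dist_lt (hE : c.minE ≤ c.maxE) (hφ : c.minφ ≤ c.maxφ)
    (h : c.dist Q < Q.rad) : (c.closedRegion ∩ Q.interior).Nonempty := by
  have hclamp : ∀ s, max c.minE (min c.maxE s) ∈ Set.Icc c.minE c.maxE :=
    fun s => ⟨le_max_left _ _, max_le hE (min_le_left _ _)⟩
  unfold Cell.dist at h
  split_ifs at h with hc
  · refine ⟨(Q.φ, max c.minE (min c.maxE Q.r)), ⟨hc, hclamp _⟩, lt_of_eq_of_lt ?_ h⟩
    rw [polarDist, ← Real.sqrt_sq_eq_abs, sub_self, Real.cos_zero]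
    congr 1
    ring
  · rcases min_lt_iff.1 h with h | h <;> rw [sideDist, polarDist_comm] at h
    · exact ⟨(c.minφ, _), ⟨⟨le_rfl, hφ⟩, hclamp _⟩, h⟩
    · exact ⟨(c.maxφ, _), ⟨⟨hφ, le_rfl⟩, hclamp _⟩, h⟩

end Cell

/-! ### Columns of a grid and circles -/

/-- The `i`-th of `N` closed angular columns. -/
def column (N i : ℕ) : Set ℝ := Set.Icc (2 * Real.pi * (i / N)) (2 * Real.pi * ((i + 1) / N))

section Column

variable {Q : Circle} {N : ℕ}

lemma column_nonempty (N i : ℕ) : (column N i).Nonempty := by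
  refine Set.nonempty_Icc.2 (mul_le_mul_of_nonneg_left ?_ (by positivity))
  gcongr
  linarith

lemma column_subset {i : ℕ} (hi : i < N) : column N i ⊆ Set.Icc 0 (2 * Real.pi) := by
  refine Set.Icc_subset_Icc (by positivity) (mul_le_of_le_one_right (by positivity) ?_)
  rw [div_le_one (by exact_mod_cast (Nat.zero_le i).trans_lt hi)]
  exact_mod_cast hi

lemma mem_column_iff (hN : 0 < N) {i : ℕ} {θ : ℝ} :
    θ ∈ column N i ↔ θ * N / (2 * Real.pi) ∈ Set.Icc (i : ℝ) (i + 1) := by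
  have hN' : (0 : ℝ) < N := by exact_mod_cast hN
  have := Real.pi_pos
  rw [column, Set.mem_Icc, Set.mem_Icc, le_div_iff₀ (by positivity), div_le_iff₀ (by positivity),
    ← mul_div_assoc, ← mul_div_assoc, div_le_iff₀ hN', le_div_iff₀ hN',
    mul_comm (i : ℝ), mul_comm ((i : ℝ) + 1)]

open scoped Classical in
lemma card_columns_meeting_le (hN : 0 < N) (Z : Finset ℝ) :
    ((Finset.range N).filter fun i => ∃ θ ∈ Z, θ ∈ column N i).card ≤ 2 * Z.card := by
  set f : ℝ → ℕ := fun θ => ⌊θ * N / (2 * Real.pi)⌋₊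
  have hsub : ((Finset.range N).filter fun i => ∃ θ ∈ Z, θ ∈ column N i) ⊆
      Z.image f ∪ Z.image fun θ => f θ - 1 := by
    intro i hi
    obtain ⟨-, θ, hθZ, hθ⟩ := Finset.mem_filter.1 hi
    obtain ⟨h1, h2⟩ := (mem_column_iff hN).1 hθ
    have hif : i ≤ f θ := Nat.le_floor h1
    have hfi : f θ ≤ i + 1 := Nat.floor_le_of_le (by exact_mod_cast h2)
    rw [Finset.mem_union, Finset.mem_image, Finset.mem_image]
    rcases hif.eq_or_lt with h | h
    · exact Or.inl ⟨θ, hθZ, h.symm⟩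
    · exact Or.inr ⟨θ, hθZ, by omega⟩
  calc _ ≤ _ := Finset.card_le_card hsub
    _ ≤ _ := Finset.card_union_le _ _
    _ ≤ Z.card + Z.card := add_le_add Finset.card_image_le Finset.card_image_le
    _ = 2 * Z.card := (two_mul _).symm

/-- The angles at distance at most `2π` from `φ` with `cos (θ - φ) = t`. -/
def anglesOfCos (φ t : ℝ) : Finset ℝ :=
  {φ + Real.arccos t, φ - Real.arccos t, φ + (2 * Real.pi - Real.arccos t),
    φ - (2 * Real.pi - Real.arccos t)}

lemma mem_anglesOfCos {θ φ : ℝ} (h : |θ - φ| ≤ 2 * Real.pi) :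
    θ ∈ anglesOfCos φ (Real.cos (θ - φ)) := by
  have hc : Real.arccos (Real.cos (θ - φ)) = |θ - φ| ∨
      Real.arccos (Real.cos (θ - φ)) = 2 * Real.pi - |θ - φ| := by
    rw [← Real.cos_abs]
    rcases le_total |θ - φ| Real.pi with h' | h'
    · exact Or.inl (Real.arccos_cos (abs_nonneg _) h')
    · rw [← Real.cos_two_pi_sub]
      exact Or.inr (Real.arccos_cos (by linarith) (by linarith))
  simp only [anglesOfCos, Finset.mem_insert, Finset.mem_singleton]
  grind

/-- By the intermediate value theorem the boundary of the circle has a point at radius `r` in the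
column, and its angle has a prescribed cosine. -/
lemma exists_mem_anglesOfCos_of_mixed (hQ : Q.Central) {i : ℕ} (hi : i < N) {r φ₁ φ₂ : ℝ}
    (h₁ : φ₁ ∈ column N i) (hin : (φ₁, r) ∈ Q.interior)
    (h₂ : φ₂ ∈ column N i) (hout : (φ₂, r) ∉ Q.interior) :
    ∃ θ ∈ anglesOfCos Q.φ ((r ^ 2 + Q.r ^ 2 - Q.rad ^ 2) / (2 * r * Q.r)), θ ∈ column N i := by
  rw [Circle.mem_interior_iff_sq_lt hQ.rad_pos] at hin hout
  rw [not_lt] at hout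
  obtain ⟨θ, hθ, hθQ⟩ := isPreconnected_Icc.intermediate_value h₁ h₂
    (f := fun φ => r ^ 2 + Q.r ^ 2 - 2 * r * Q.r * Real.cos (φ - Q.φ))
    (by fun_prop) ⟨hin.le, hout⟩
  have hne : 2 * r * Q.r ≠ 0 := by
    intro h
    rw [h] at hin hout
    linarith
  have hcos : (r ^ 2 + Q.r ^ 2 - Q.rad ^ 2) / (2 * r * Q.r) = Real.cos (θ - Q.φ) := by
    rw [div_eq_iff hne]
    linarith
  obtain ⟨h0, h2π⟩ := column_subset hi hθ
  rw [hcos]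
  exact ⟨θ, mem_anglesOfCos (abs_le.2 ⟨by linarith [hQ.φ_lt], by linarith [hQ.φ_nonneg]⟩), hθ⟩

open scoped Classical in
lemma card_mixed_columns_le (hQ : Q.Central) (hN : 0 < N) (r : ℝ) :
    ((Finset.range N).filter fun i => (∃ φ ∈ column N i, (φ, r) ∈ Q.interior) ∧
      ∃ φ ∈ column N i, (φ, r) ∉ Q.interior).card ≤ 8 := by
  set Z := anglesOfCos Q.φ ((r ^ 2 + Q.r ^ 2 - Q.rad ^ 2) / (2 * r * Q.r))
  calc _ ≤ ((Finset.range N).filter fun i => ∃ θ ∈ Z, θ ∈ column N i).card := by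
        refine Finset.card_le_card fun i hi => ?_
        obtain ⟨hiN, ⟨φ₁, h₁, hin⟩, φ₂, h₂, hout⟩ := Finset.mem_filter.1 hi
        exact Finset.mem_filter.2 ⟨hiN,
          exists_mem_anglesOfCos_of_mixed hQ (Finset.mem_range.1 hiN) h₁ hin h₂ hout⟩
    _ ≤ 2 * Z.card := card_columns_meeting_le hN Z
    _ ≤ 8 := by
        have : Z.card ≤ 4 := Finset.card_le_four
        omega

end Column

/-- Up to at most `b` elements, the summands are the telescoping differences `O j \ O (j + 1)`. -/
lemma sum_card_sdiff_succ_le {ι : Type*} [DecidableEq ι] {I O : ℕ → Finset ι} {b : ℕ}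
    (hOI : ∀ j, O j ⊆ I j) (hO : ∀ j, O (j + 1) ⊆ O j) (hb : ∀ j, (I j \ O j).card ≤ b)
    (m : ℕ) : ∑ j ∈ Finset.range m, (I j \ O (j + 1)).card ≤ (O 0).card + b * m := by
  suffices ∑ j ∈ Finset.range m, (I j \ O (j + 1)).card + (O m).card ≤ (O 0).card + b * m by omega
  induction m with
  | zero => simp
  | succ m ih =>
    have h1 := Finset.card_sdiff_add_card_eq_card ((hO m).trans (hOI m))
    have h2 := Finset.card_sdiff_add_card_eq_card (hOI m)
    have h3 := hb m
    rw [Finset.sum_range_succ, mul_add_one]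
    omega

open scoped Classical in
/-- The columns in which the circle `r = ρ j` runs inside `Q` form a decreasing family in `j`, so a
column leaves it only once, and in each row at most eight columns are cut by the boundary. -/
lemma card_boundary_cells_le {Q : Circle} (hQ : Q.Central) {N : ℕ} (hN : 0 < N) {ρ : ℕ → ℝ}
    (hρ : Monotone ρ) (hρ0 : 0 ≤ ρ 0) :
    ((Finset.range N ×ˢ Finset.range N).filter fun c : ℕ × ℕ =>
      (∃ φ ∈ column N c.1, (φ, ρ c.2) ∈ Q.interior) ∧
      ∃ φ ∈ column N c.1, (φ, ρ (c.2 + 1)) ∉ Q.interior).card ≤ 9 * N := by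
  set I : ℕ → Finset ℕ := fun j => (Finset.range N).filter fun i =>
    ∃ φ ∈ column N i, (φ, ρ j) ∈ Q.interior with hI
  set O : ℕ → Finset ℕ := fun j => (Finset.range N).filter fun i =>
    ∀ φ ∈ column N i, (φ, ρ j) ∈ Q.interior with hO
  have hOI : ∀ j, O j ⊆ I j := fun j => Finset.monotone_filter_right _ fun i _ h => by
    obtain ⟨φ, hφ⟩ := column_nonempty N i
    exact ⟨φ, hφ, h φ hφ⟩
  have hOO : ∀ j, O (j + 1) ⊆ O j := fun j => Finset.monotone_filter_right _ fun i _ h φ hφ =>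
    hQ.mem_interior_of_le (h φ hφ) (hρ0.trans (hρ j.zero_le)) (hρ j.le_succ)
  have hmixed : ∀ j, (I j \ O j).card ≤ 8 := fun j => by
    refine le_trans (Finset.card_le_card fun i hi => ?_) (card_mixed_columns_le hQ hN (ρ j))
    simp only [hI, hO, Finset.mem_sdiff, Finset.mem_filter] at hi ⊢
    grind
  calc _ = ∑ j ∈ Finset.range N, (I j \ O (j + 1)).card := by
        rw [← Finset.card_sigma]
        refine Finset.card_bij' (fun c _ => ⟨c.2, c.1⟩) (fun c _ => (c.2, c.1)) ?_ ?_ ?_ ?_ <;>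
          simp only [hI, hO, Finset.mem_sigma, Finset.mem_sdiff, Finset.mem_filter,
            Finset.mem_product] <;> grind
    _ ≤ (O 0).card + 8 * N := sum_card_sdiff_succ_le hOI hOO hmixed N
    _ ≤ N + 8 * N := by
        gcongr
        simpa using Finset.card_filter_le (Finset.range N) _
    _ = 9 * N := by ring

/-! ### The grid of potential quadtree cells -/

namespace Cell

variable {c : Cell} {α : ℝ} {p : ℝ × ℝ}

lemma diskPolar_mem_closedRegion (h0 : 0 ≤ c.minH) (hp : p ∈ c.region) :
    diskPolar p ∈ c.closedRegion := by
  obtain ⟨hφ, hr, hr'⟩ := hp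
  have hmono := strictMonoOn_mapToPoincare.monotoneOn
  exact ⟨Set.Ico_subset_Icc_self hφ, hmono h0 (h0.trans hr) hr,
    hmono (h0.trans hr) (h0.trans (hr.trans hr'.le)) hr'.le⟩

lemma quadrant_eq_iff (h0 : 0 ≤ c.minH) (hmid : 0 ≤ c.midH α) {V : Type} (v : V)
    (hp : p ∈ c.region) (q : Bool × Bool) :
    c.quadrant α ⟨v, p.1, mapToPoincare p.2⟩ = q ↔ p ∈ (c.sub α q).region := by
  obtain ⟨⟨h1, h2⟩, h3, h4⟩ := hp
  have hE : c.midE α ≤ mapToPoincare p.2 ↔ c.midH α ≤ p.2 :=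
    strictMonoOn_mapToPoincare.le_iff_le hmid (h0.trans h3)
  obtain ⟨a, b⟩ := q
  simp only [quadrant, hE, Prod.mk.injEq, region, sub, Set.mem_prod, Set.mem_Ico]
  cases a <;> cases b <;> simp [h1, h2, h3, h4]

end Cell

/-- The native radius below which a fraction `u` of the radial mass lies. -/
def radialQuantile (α R u : ℝ) : ℝ := Real.arcosh (1 + (Real.cosh (α * R) - 1) * u) / α

/-- The cell in column `c.1` and row `c.2` of the `N × N` grid of cells of equal probability
mass. -/
def gridCell (α R : ℝ) (N : ℕ) (c : ℕ × ℕ) : Cell where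
  minφ := 2 * Real.pi * (c.1 / N)
  maxφ := 2 * Real.pi * ((c.1 + 1) / N)
  minH := radialQuantile α R (c.2 / N)
  maxH := radialQuantile α R ((c.2 + 1) / N)

/-- The indices of the `N × N` grid. -/
def grid (N : ℕ) : Finset (ℕ × ℕ) := Finset.range N ×ˢ Finset.range N

/-- Indices, in the grid of half the mesh size, of the children of a grid cell. -/
def childIndex (c : ℕ × ℕ) (q : Bool × Bool) : ℕ × ℕ := (2 * c.1 + q.1.toNat, 2 * c.2 + q.2.toNat)

/-- Index of the cell that contains a given cell of an `M` times finer grid. -/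
def ancestorIndex (M : ℕ) (c : ℕ × ℕ) : ℕ × ℕ := (c.1 / M, c.2 / M)

lemma ancestorIndex_mem_grid {N M : ℕ} {c : ℕ × ℕ} (hc : c ∈ grid (N * M)) :
    ancestorIndex M c ∈ grid N := by
  simp only [grid, Finset.mem_product, Finset.mem_range] at hc ⊢
  exact ⟨Nat.div_lt_of_lt_mul (mul_comm N M ▸ hc.1), Nat.div_lt_of_lt_mul (mul_comm N M ▸ hc.2)⟩

section Grid

variable {α R : ℝ} {N : ℕ} {c : ℕ × ℕ}

lemma one_le_quantile_arg (α R : ℝ) {u : ℝ} (hu : 0 ≤ u) :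
    1 ≤ 1 + (Real.cosh (α * R) - 1) * u := by
  have := mul_nonneg (sub_nonneg.2 (Real.one_le_cosh (α * R))) hu
  linarith

lemma cosh_radialQuantile (hα : α ≠ 0) {u : ℝ} (hu : 0 ≤ u) :
    Real.cosh (α * radialQuantile α R u) = 1 + (Real.cosh (α * R) - 1) * u := by
  rw [radialQuantile, mul_div_cancel₀ _ hα, Real.cosh_arcosh (one_le_quantile_arg α R hu)]

lemma radialQuantile_zero (α R : ℝ) : radialQuantile α R 0 = 0 := by
  simp [radialQuantile]

lemma radialQuantile_one (hα : 0 < α) (hR : 0 ≤ R) : radialQuantile α R 1 = R := by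
  rw [radialQuantile, mul_one, add_sub_cancel, Real.arcosh_cosh (mul_nonneg hα.le hR),
    mul_div_cancel_left₀ _ hα.ne']

lemma radialQuantile_nonneg (hα : 0 ≤ α) {u : ℝ} (hu : 0 ≤ u) : 0 ≤ radialQuantile α R u :=
  div_nonneg (Real.arcosh_nonneg (one_le_quantile_arg α R hu)) hα

lemma strictMonoOn_radialQuantile (hα : 0 < α) (hR : 0 < R) :
    StrictMonoOn (radialQuantile α R) (Set.Ici 0) := by
  intro u hu v hv huv
  have h1 := one_le_quantile_arg α R hu
  have h2 := one_le_quantile_arg α R hv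
  refine div_lt_div_of_pos_right ((Real.arcosh_lt_arcosh (by linarith) (by linarith)).2 ?_) hα
  have := mul_lt_mul_of_pos_left huv (sub_pos.2 (Real.one_lt_cosh.2 (mul_pos hα hR).ne'))
  linarith

lemma monotone_grid_radius (hα : 0 < α) (hR : 0 < R) (N : ℕ) :
    Monotone fun j : ℕ => mapToPoincare (radialQuantile α R (j / N)) := by
  intro j k hjk
  have hjk' : (j : ℝ) / N ≤ k / N := by gcongr
  have hj : (0 : ℝ) ≤ j / N := by positivity
  have hk : (0 : ℝ) ≤ k / N := by positivity
  exact strictMonoOn_mapToPoincare.monotoneOn (radialQuantile_nonneg hα.le hj)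
    (radialQuantile_nonneg hα.le hk) ((strictMonoOn_radialQuantile hα hR).monotoneOn hj hk hjk')

lemma gridCell_one (hα : 0 < α) (hR : 0 ≤ R) :
    gridCell α R 1 (0, 0) = ⟨0, 2 * Real.pi, 0, R⟩ := by
  simp [gridCell, radialQuantile_zero, radialQuantile_one hα hR]

lemma gridCell_minH_nonneg (hα : 0 ≤ α) : 0 ≤ (gridCell α R N c).minH :=
  radialQuantile_nonneg hα (by positivity)

lemma gridCell_maxE (α R : ℝ) (N : ℕ) (c : ℕ × ℕ) : (gridCell α R N c).maxE =
    mapToPoincare (radialQuantile α R ((c.2 + 1 : ℕ) / N)) := by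
  rw [Nat.cast_add_one]
  rfl

lemma gridCell_minE_le_maxE (hα : 0 < α) (hR : 0 < R) :
    (gridCell α R N c).minE ≤ (gridCell α R N c).maxE := by
  rw [gridCell_maxE]
  exact monotone_grid_radius hα hR N c.2.le_succ

lemma gridCell_midH (hα : α ≠ 0) (N : ℕ) (c : ℕ × ℕ) :
    (gridCell α R N c).midH α = radialQuantile α R ((2 * c.2 + 1) / (2 * N)) := by
  rw [Cell.midH, radialQuantile]
  congr 2
  simp only [gridCell]
  rw [cosh_radialQuantile hα (by positivity), cosh_radialQuantile hα (by positivity)]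
  rcases eq_or_ne (N : ℝ) 0 with hN | hN
  · simp [hN]
  · field_simp
    ring

lemma gridCell_midφ (α R : ℝ) (N : ℕ) (c : ℕ × ℕ) :
    (gridCell α R N c).midφ = 2 * Real.pi * ((2 * c.1 + 1) / (2 * N)) := by
  simp only [gridCell, Cell.midφ]
  rcases eq_or_ne (N : ℝ) 0 with hN | hN
  · simp [hN]
  · field_simp
    ring

lemma gridCell_sub (hα : α ≠ 0) (N : ℕ) (c : ℕ × ℕ) (q : Bool × Bool) :
    (gridCell α R N c).sub α q = gridCell α R (2 * N) (childIndex c q) := by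
  have hlo (k : ℕ) : (2 * (k : ℝ)) / (2 * N) = k / N := mul_div_mul_left _ _ two_ne_zero
  have hhi (k : ℕ) : (2 * (k : ℝ) + 1 + 1) / (2 * N) = (k + 1) / N := by
    rw [← mul_div_mul_left ((k : ℝ) + 1) _ two_ne_zero]
    ring
  obtain ⟨a, b⟩ := q
  rw [Cell.sub, gridCell_midH hα, gridCell_midφ]
  cases a <;> cases b <;> simp [gridCell, childIndex, hlo, hhi]

lemma gridCell_quadrant_eq_iff (hα : 0 < α) {V : Type} (v : V) {p : ℝ × ℝ}
    (hp : p ∈ (gridCell α R N c).region) (q : Bool × Bool) :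
    (gridCell α R N c).quadrant α ⟨v, p.1, mapToPoincare p.2⟩ = q ↔
      p ∈ (gridCell α R (2 * N) (childIndex c q)).region := by
  rw [← gridCell_sub hα.ne']
  refine Cell.quadrant_eq_iff (gridCell_minH_nonneg hα.le) ?_ v hp q
  rw [gridCell_midH hα.ne']
  exact radialQuantile_nonneg hα.le (by positivity)

lemma diskPolar_mem_closedRegion_gridCell (hα : 0 ≤ α) {p : ℝ × ℝ}
    (hp : p ∈ (gridCell α R N c).region) : diskPolar p ∈ (gridCell α R N c).closedRegion :=
  Cell.diskPolar_mem_closedRegion (gridCell_minH_nonneg hα) hp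

lemma gridCell_dist_le (hc : c.1 < N) {Q : Circle} (hQ : Q.Central) {p : ℝ × ℝ}
    (hp : p ∈ (gridCell α R N c).closedRegion) :
    (gridCell α R N c).dist Q ≤ polarDist p.1 p.2 Q.φ Q.r :=
  Cell.dist_le hQ (mapToPoincare_nonneg _) (by simp only [gridCell]; positivity)
    (column_subset hc (Set.right_mem_Icc.2 (Set.nonempty_Icc.1 (column_nonempty N c.1)))).2 hp

lemma gridCell_meets_interior_of_dist_lt (hα : 0 < α) (hR : 0 < R) {Q : Circle}
    (h : (gridCell α R N c).dist Q < Q.rad) :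
    ((gridCell α R N c).closedRegion ∩ Q.interior).Nonempty :=
  Cell.meets_interior_of_dist_lt (gridCell_minE_le_maxE hα hR)
    (Set.nonempty_Icc.1 (column_nonempty N c.1)) h

lemma index_eq_of_mem {f : ℝ → ℝ} (hf : StrictMonoOn f (Set.Ici 0)) {i j : ℕ} {y : ℝ}
    (hi : y ∈ Set.Ico (f (i / N)) (f ((i + 1) / N)))
    (hj : y ∈ Set.Ico (f (j / N)) (f ((j + 1) / N))) : i = j := by
  have hle : ∀ a b : ℕ, f (a / N) ≤ y → y < f ((b + 1) / N) → a ≤ b := by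
    intro a b ha hb
    by_contra! hab
    have hdiv : ((b : ℝ) + 1) / N ≤ a / N := by
      gcongr
      exact_mod_cast hab
    exact (ha.trans_lt hb).not_ge (hf.monotoneOn (Set.mem_Ici.2 (by positivity))
      (Set.mem_Ici.2 (by positivity)) hdiv)
  exact le_antisymm (hle i j hi.1 hj.2) (hle j i hj.1 hi.2)

lemma strictMonoOn_two_pi_mul : StrictMonoOn (fun u : ℝ => 2 * Real.pi * u) (Set.Ici 0) :=
  fun _ _ _ _ h => mul_lt_mul_of_pos_left h Real.two_pi_pos

lemma gridCell_index_eq (hα : 0 < α) (hR : 0 < R) {c' : ℕ × ℕ} {p : ℝ × ℝ}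
    (h : p ∈ (gridCell α R N c).region) (h' : p ∈ (gridCell α R N c').region) : c = c' :=
  Prod.ext (index_eq_of_mem strictMonoOn_two_pi_mul h.1 h'.1)
    (index_eq_of_mem (strictMonoOn_radialQuantile hα hR) h.2 h'.2)

lemma ancestor_bounds (N : ℕ) {M : ℕ} (hM : 0 < M) (i : ℕ) :
    (((i / M : ℕ) : ℝ) / N ≤ i / (N * M : ℕ)) ∧
      ((i : ℝ) + 1) / (N * M : ℕ) ≤ ((i / M : ℕ) + 1) / N := by
  have hM' : (0 : ℝ) < M := by exact_mod_cast hM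
  have h1 : ((i / M : ℕ) : ℝ) * M ≤ i := by exact_mod_cast Nat.div_mul_le_self i M
  have h2 : (i : ℝ) + 1 ≤ ((i / M : ℕ) + 1) * M := by
    exact_mod_cast Nat.lt_mul_of_div_lt (Nat.lt_succ_self (i / M)) hM
  rw [Nat.cast_mul, ← mul_div_mul_right ((i / M : ℕ) : ℝ) _ hM'.ne',
    ← mul_div_mul_right (((i / M : ℕ) : ℝ) + 1) _ hM'.ne']
  exact ⟨by gcongr, by gcongr⟩

lemma gridCell_ancestor_angles (α R : ℝ) (N : ℕ) {M : ℕ} (hM : 0 < M) (c : ℕ × ℕ) :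
    (gridCell α R N (ancestorIndex M c)).minφ ≤ (gridCell α R (N * M) c).minφ ∧
      (gridCell α R (N * M) c).maxφ ≤ (gridCell α R N (ancestorIndex M c)).maxφ :=
  (ancestor_bounds N hM c.1).imp (mul_le_mul_of_nonneg_left · Real.two_pi_pos.le)
    (mul_le_mul_of_nonneg_left · Real.two_pi_pos.le)

lemma gridCell_ancestor_radii (hα : 0 < α) (hR : 0 < R) (N : ℕ) {M : ℕ} (hM : 0 < M)
    (c : ℕ × ℕ) :
    (gridCell α R N (ancestorIndex M c)).minH ≤ (gridCell α R (N * M) c).minH ∧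
      (gridCell α R (N * M) c).maxH ≤ (gridCell α R N (ancestorIndex M c)).maxH :=
  have hmono := (strictMonoOn_radialQuantile hα hR).monotoneOn
  (ancestor_bounds N hM c.2).imp
    (hmono (Set.mem_Ici.2 (by positivity)) (Set.mem_Ici.2 (by positivity)) ·)
    (hmono (Set.mem_Ici.2 (by positivity)) (Set.mem_Ici.2 (by positivity)) ·)

lemma region_subset_ancestor (hα : 0 < α) (hR : 0 < R) {M : ℕ} (hM : 0 < M) :
    (gridCell α R (N * M) c).region ⊆ (gridCell α R N (ancestorIndex M c)).region :=
  have hφ := gridCell_ancestor_angles α R N hM c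
  have hr := gridCell_ancestor_radii hα hR N hM c
  Set.prod_mono (Set.Ico_subset_Ico hφ.1 hφ.2) (Set.Ico_subset_Ico hr.1 hr.2)

lemma closedRegion_subset_ancestor (hα : 0 < α) (hR : 0 < R) {M : ℕ} (hM : 0 < M) :
    (gridCell α R (N * M) c).closedRegion ⊆
      (gridCell α R N (ancestorIndex M c)).closedRegion := by
  have hφ := gridCell_ancestor_angles α R N hM c
  have hr := gridCell_ancestor_radii hα hR N hM c
  have hmono := strictMonoOn_mapToPoincare.monotoneOn
  have hmax : ∀ {N c}, 0 ≤ (gridCell α R N c).maxH := radialQuantile_nonneg hα.le (by positivity)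
  exact Set.prod_mono (Set.Icc_subset_Icc hφ.1 hφ.2) (Set.Icc_subset_Icc
    (hmono (gridCell_minH_nonneg hα.le) (gridCell_minH_nonneg hα.le) hr.1) (hmono hmax hmax hr.2))

lemma Cell.Straddles.ancestor (hα : 0 < α) (hR : 0 < R) {M : ℕ} (hM : 0 < M) {Q : Circle}
    (h : (gridCell α R (N * M) c).Straddles Q) :
    (gridCell α R N (ancestorIndex M c)).Straddles Q :=
  have hsub := closedRegion_subset_ancestor hα hR hM
  ⟨h.1.mono (Set.inter_subset_inter_left _ hsub), fun h' => h.2 (hsub.trans h')⟩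

open scoped Classical in
/-- The indices of the cells of the `N × N` grid that the circle straddles. -/
def straddlingCells (α R : ℝ) (N : ℕ) (Q : Circle) : Finset (ℕ × ℕ) :=
  (grid N).filter fun c => (gridCell α R N c).Straddles Q

theorem card_straddlingCells_le (hα : 0 < α) (hR : 0 < R) {Q : Circle} (hQ : Q.Central)
    (hN : 0 < N) : (straddlingCells α R N Q).card ≤ 9 * N := by
  classical
  refine le_trans (Finset.card_le_card fun c hc => ?_) (card_boundary_cells_le hQ hN
    (monotone_grid_radius hα hR N) (mapToPoincare_nonneg _))
  obtain ⟨hgrid, ⟨p, ⟨hpφ, hpr, -⟩, hpQ⟩, hexit⟩ := Finset.mem_filter.1 hc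
  obtain ⟨p', ⟨hpφ', hpr₁, hpr₂⟩, hpQ'⟩ := Set.not_subset.1 hexit
  rw [gridCell_maxE] at hpr₂
  exact Finset.mem_filter.2 ⟨hgrid,
    ⟨p.1, hpφ, hQ.mem_interior_of_le hpQ (mapToPoincare_nonneg _) hpr⟩, p'.1, hpφ',
    fun h => hpQ' (hQ.mem_interior_of_le h ((mapToPoincare_nonneg _).trans hpr₁) hpr₂)⟩

end Grid

/-! ### Insertion -/

namespace Timed

lemma returns_pure {β : Type} (b : β) : (pure b : Timed β).Returns b 0 := rfl

lemma returns_tick (k : ℕ) : (tick k).Returns () k := rfl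

lemma Returns.bind {β γ : Type} {m : Timed β} {f : β → Timed γ} {b : β} {b' : γ} {s t : ℕ}
    (hm : m.Returns b s) (hf : (f b).Returns b' t) : (m >>= f).Returns b' (s + t) := by
  unfold Returns at *
  subst hm
  change Option.map _ (f b) = _
  rw [hf]
  rfl

end Timed

/-- The record stored for the vertex `v` at position `x v`. -/
def item {V : Type} (x : V → ℝ × ℝ) (v : V) : Item V := ⟨v, (x v).1, mapToPoincare (x v).2⟩

/-- `T` is a quadtree for the cell `c` of the `N × N` grid storing exactly the vertices in `S`; its
inner nodes are responsible for more than `cap` vertices. -/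
def Stores {V : Type} (α R : ℝ) (cap : ℕ) (x : V → ℝ × ℝ) :
    QuadTree V → ℕ → ℕ × ℕ → Finset V → Prop
  | .leaf cell pts, N, c, S => cell = gridCell α R N c ∧ pts.length ≤ cap ∧
      (pts : Multiset (Item V)) = S.val.map (item x)
  | .node cell child, N, c, S => cell = gridCell α R N c ∧ cap < S.card ∧
      ∀ q, Stores α R cap x (child q) (2 * N) (childIndex c q)
        (S.filter fun v => cell.quadrant α (item x v) = q)

/-- No two points lie in the same cell of the `N × N` grid. -/
def Separated {V : Type} (α R : ℝ) (x : V → ℝ × ℝ) (N : ℕ) : Prop :=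
  ∀ c, (x ⁻¹' (gridCell α R N c).region).Subsingleton

/-- Inserting `v` into `T` succeeds within recursion depth `D` and `B` steps, and the resulting
tree stores the vertices in `S`. -/
def Inserts {V : Type} (α R : ℝ) (cap : ℕ) (x : V → ℝ × ℝ) (T : QuadTree V) (v : V) (N : ℕ)
    (c : ℕ × ℕ) (S : Finset V) (D B : ℕ) : Prop :=
  ∃ T' t, (∀ d, D ≤ d → (RHG.insert α cap d T (item x v)).Returns T' t) ∧
    Stores α R cap x T' N c S ∧ t ≤ B

section Insertion

variable {V : Type} {α R : ℝ} {cap : ℕ} {x : V → ℝ × ℝ} {N : ℕ} {c : ℕ × ℕ} {S : Finset V}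
  {v : V} {D B : ℕ}

lemma Separated.card_le_one (h : Separated α R x N)
    (hS : ∀ w ∈ S, x w ∈ (gridCell α R N c).region) : S.card ≤ 1 :=
  Finset.card_le_one.2 fun v hv w hw => h c (hS v hv) (hS w hw)

lemma length_eq_card_of_stores_leaf {cell : Cell} {pts : List (Item V)}
    (h : Stores α R cap x (.leaf cell pts) N c S) : pts.length = S.card := by
  rw [← Multiset.coe_card, h.2.2, Multiset.card_map, Finset.card_val]

lemma mem_child_region (hα : 0 < α) (hS : ∀ w ∈ S, x w ∈ (gridCell α R N c).region)
    (q : Bool × Bool) :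
    ∀ w ∈ S.filter fun w => (gridCell α R N c).quadrant α (item x w) = q,
      x w ∈ (gridCell α R (2 * N) (childIndex c q)).region := by
  intro w hw
  obtain ⟨hwS, hq⟩ := Finset.mem_filter.1 hw
  exact (gridCell_quadrant_eq_iff hα w (hS w hwS) q).1 hq

lemma Inserts.mono {T : QuadTree V} {D' B' : ℕ} (h : Inserts α R cap x T v N c S D B)
    (hD : D ≤ D') (hB : B ≤ B') : Inserts α R cap x T v N c S D' B' := by
  obtain ⟨T', t, hret, hT', ht⟩ := h
  exact ⟨T', t, fun d hd => hret d (hD.trans hd), hT', ht.trans hB⟩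

lemma inserts_leaf {cell : Cell} {pts : List (Item V)}
    (hT : Stores α R cap x (.leaf cell pts) N c S) (hv : v ∉ S) (hlt : pts.length < cap) :
    Inserts α R cap x (.leaf cell pts) v N c (S.cons v hv) 1 cap := by
  refine ⟨.leaf cell (item x v :: pts), pts.length + 1 + 0, fun d hd => ?_, ?_, hlt⟩
  · obtain ⟨d, rfl⟩ := Nat.exists_eq_add_of_le' hd
    rw [RHG.insert, if_pos hlt]
    exact (Timed.returns_tick _).bind (Timed.returns_pure _)
  · refine ⟨hT.1, hlt, ?_⟩
    rw [← Multiset.cons_coe, hT.2.2, Finset.cons_val, Multiset.map_cons]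

lemma inserts_node {child : Bool × Bool → QuadTree V} (hv : v ∉ S)
    (hchild : ∀ q, Stores α R cap x (child q) (2 * N) (childIndex c q)
      (S.filter fun w => (gridCell α R N c).quadrant α (item x w) = q))
    (hcard : cap < (S.cons v hv).card)
    (hins : ∀ q, (gridCell α R N c).quadrant α (item x v) = q →
      Inserts α R cap x (child q) v (2 * N) (childIndex c q)
        ((S.cons v hv).filter fun w => (gridCell α R N c).quadrant α (item x w) = q) D B) :
    Inserts α R cap x (.node (gridCell α R N c) child) v N c (S.cons v hv) (D + 1) (B + 1) := by
  set q₀ := (gridCell α R N c).quadrant α (item x v)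
  obtain ⟨T', t, hret, hT', ht⟩ := hins q₀ rfl
  refine ⟨.node (gridCell α R N c) (Function.update child q₀ T'), 1 + (t + 0), fun d hd => ?_,
    ⟨rfl, hcard, fun q => ?_⟩, by omega⟩
  · obtain ⟨d, rfl⟩ := Nat.exists_eq_add_of_le' (Nat.le_of_add_left_le hd)
    rw [RHG.insert]
    exact (Timed.returns_tick 1).bind ((hret d (by omega)).bind (Timed.returns_pure _))
  · rcases eq_or_ne q q₀ with rfl | hq
    · rwa [Function.update_self]
    · rw [Function.update_of_ne hq, Finset.filter_cons_of_neg
        (fun w => (gridCell α R N c).quadrant α (item x w) = q) v S hv hq.symm]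
      exact hchild q

lemma returns_splitLeaf (cell : Cell) (pts : List (Item V)) :
    (splitLeaf α cell pts).Returns (.node cell fun q => .leaf (cell.sub α q)
      (pts.filter fun p => cell.quadrant α p = q)) (4 * (pts.length + 1) + 0) :=
  (Timed.returns_tick _).bind (Timed.returns_pure _)

lemma stores_splitLeaf (hα : α ≠ 0) {pts : List (Item V)}
    (hT : Stores α R cap x (.leaf (gridCell α R N c) pts) N c S) (q : Bool × Bool) :
    Stores α R cap x (.leaf ((gridCell α R N c).sub α q)
        (pts.filter fun p => (gridCell α R N c).quadrant α p = q)) (2 * N) (childIndex c q)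
      (S.filter fun w => (gridCell α R N c).quadrant α (item x w) = q) := by
  refine ⟨gridCell_sub hα N c q, (List.length_filter_le _ _).trans hT.2.1, ?_⟩
  rw [Finset.filter_val, ← Multiset.filter_coe, hT.2.2, Multiset.filter_map]
  rfl

lemma inserts_full_leaf (hα : α ≠ 0) {pts : List (Item V)} {S' : Finset V}
    (hT : Stores α R cap x (.leaf (gridCell α R N c) pts) N c S) (hfull : cap ≤ pts.length)
    (hins : ∀ child, (∀ q, Stores α R cap x (child q) (2 * N) (childIndex c q)
        (S.filter fun w => (gridCell α R N c).quadrant α (item x w) = q)) →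
      Inserts α R cap x (.node (gridCell α R N c) child) v N c S' D B) :
    Inserts α R cap x (.leaf (gridCell α R N c) pts) v N c S' (D + 1) (B + 5 * (cap + 1)) := by
  obtain ⟨T', t, hret, hT', ht⟩ := hins _ (stores_splitLeaf hα hT)
  refine ⟨T', pts.length + 1 + (4 * (pts.length + 1) + 0 + t), fun d hd => ?_, hT', ?_⟩
  · obtain ⟨d, rfl⟩ := Nat.exists_eq_add_of_le' (Nat.le_of_add_left_le hd)
    rw [RHG.insert, if_neg hfull.not_gt]
    exact (Timed.returns_tick _).bind ((returns_splitLeaf _ _).bind (hret d (by omega)))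
  · have := hT.2.1
    omega

lemma inserts_of_card_le_one (hcap : 1 ≤ cap) {T : QuadTree V} (hT : Stores α R cap x T N c S)
    (hv : v ∉ S) (hcard : (S.cons v hv).card ≤ 1) :
    Inserts α R cap x T v N c (S.cons v hv) 1 cap := by
  rw [Finset.card_cons] at hcard
  cases T with
  | leaf cell pts =>
    have hlen := length_eq_card_of_stores_leaf hT
    exact inserts_leaf hT hv (by omega)
  | node cell child =>
    have := hT.2.1
    omega

/-- Below a cell of the separated grid there is no further split, so the depth is bounded. -/
theorem inserts_of_separated (hα : 0 < α) (hcap : 1 ≤ cap) {k : ℕ} {T : QuadTree V}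
    (hsep : Separated α R x (N * 2 ^ k)) (hT : Stores α R cap x T N c S) (hv : v ∉ S)
    (hS : ∀ w ∈ S.cons v hv, x w ∈ (gridCell α R N c).region) :
    Inserts α R cap x T v N c (S.cons v hv) (2 * k + 1) ((k + 1) * (5 * (cap + 1) + 1)) := by
  induction k generalizing T N c S with
  | zero =>
    rw [pow_zero, mul_one] at hsep
    exact (inserts_of_card_le_one hcap hT hv (hsep.card_le_one hS)).mono (by omega) (by omega)
  | succ k ih =>
    rw [pow_succ', ← mul_assoc, mul_comm N] at hsep
    have hbound : (k + 1 + 1) * (5 * (cap + 1) + 1) =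
      (k + 1) * (5 * (cap + 1) + 1) + 1 + 5 * (cap + 1) := by ring
    have hnode : ∀ child : Bool × Bool → QuadTree V,
        (∀ q, Stores α R cap x (child q) (2 * N) (childIndex c q)
          (S.filter fun w => (gridCell α R N c).quadrant α (item x w) = q)) →
        cap < (S.cons v hv).card →
        Inserts α R cap x (.node (gridCell α R N c) child) v N c (S.cons v hv) (2 * k + 1 + 1)
          ((k + 1) * (5 * (cap + 1) + 1) + 1) := by
      refine fun child hchild hcard => inserts_node hv hchild hcard fun q hq => ?_
      have hregion := mem_child_region hα hS q
      simp only [Finset.filter_cons_of_pos, hq] at hregion ⊢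
      exact ih hsep (hchild q) _ hregion
    cases T with
    | leaf cell pts =>
      rcases lt_or_ge pts.length cap with hlt | hfull
      · refine (inserts_leaf hT hv hlt).mono (by omega) ?_
        rw [hbound]
        omega
      · obtain rfl := hT.1
        have hcard : cap < (S.cons v hv).card := by
          rw [Finset.card_cons, ← length_eq_card_of_stores_leaf hT]
          omega
        exact (inserts_full_leaf hα.ne' hT hfull fun child hchild =>
          hnode child hchild hcard).mono le_rfl hbound.ge
    | node cell child =>
      obtain ⟨rfl, hcard, hchild⟩ := hT
      refine (hnode child hchild ?_).mono (by omega) (by omega)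
      rw [Finset.card_cons]
      omega

theorem insertLoop_stores (hα : 0 < α) (hcap : 1 ≤ cap) {k : ℕ}
    (hsep : Separated α R x (2 ^ k)) (hx : ∀ v, x v ∈ (gridCell α R 1 (0, 0)).region)
    {vs : List V} {T : QuadTree V} {S' : Finset V} (hT : Stores α R cap x T 1 (0, 0) S)
    (hS' : S'.val = S.val + vs) :
    ∃ T' t, (∀ d, 2 * k + 1 ≤ d → (insertLoop α cap d x vs T).Returns T' t) ∧
      Stores α R cap x T' 1 (0, 0) S' ∧ t ≤ vs.length * ((k + 1) * (5 * (cap + 1) + 1) + 1) := by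
  induction vs generalizing T S with
  | nil =>
    obtain rfl : S' = S := Finset.val_injective (by simpa using hS')
    exact ⟨T, 0, fun _ _ => Timed.returns_pure T, hT, by simp⟩
  | cons v vs ih =>
    rw [← Multiset.cons_coe, Multiset.add_cons] at hS'
    have hv : v ∉ S := fun h => (Multiset.nodup_cons.1 (hS' ▸ S'.nodup)).1
      (Multiset.mem_add.2 (Or.inl h))
    rw [← Multiset.cons_add] at hS'
    obtain ⟨T₁, t₁, hret₁, hT₁, ht₁⟩ := inserts_of_separated (N := 1) hα hcap
      (by rwa [one_mul]) hT hv (fun w _ => hx w)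
    obtain ⟨T₂, t₂, hret₂, hT₂, ht₂⟩ := ih hT₁ hS'
    refine ⟨T₂, 1 + (t₁ + t₂), fun d hd => ?_, hT₂, ?_⟩
    · rw [insertLoop]
      exact (Timed.returns_tick 1).bind ((hret₁ d hd).bind (hret₂ d hd))
    · rw [List.length_cons, add_one_mul]
      omega

end Insertion

/-! ### Range queries -/

/-- The sum of `w` over the descendants of the grid cell `c` in the next `k` levels, itself
included. -/
def subtreeSum (w : ℕ → ℕ × ℕ → ℕ) : ℕ → ℕ → ℕ × ℕ → ℕ
  | 0, _, _ => 0
  | k + 1, N, c => w N c + ∑ q, subtreeSum w k (2 * N) (childIndex c q)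

lemma sum_range_two_mul (f : ℕ → ℕ) (N : ℕ) :
    ∑ i ∈ Finset.range (2 * N), f i = ∑ i ∈ Finset.range N, (f (2 * i) + f (2 * i + 1)) := by
  induction N with
  | zero => rfl
  | succ N ih =>
    rw [mul_add_one, Finset.sum_range_succ, Finset.sum_range_succ, Finset.sum_range_succ, ih]
    ring

lemma sum_grid_childIndex (f : ℕ × ℕ → ℕ) (N : ℕ) :
    ∑ c ∈ grid N, ∑ q, f (childIndex c q) = ∑ c ∈ grid (2 * N), f c := by
  simp only [grid, Finset.sum_product, sum_range_two_mul, childIndex, Fintype.sum_prod_type,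
    Fintype.sum_bool, Bool.toNat_true, Bool.toNat_false, add_zero, ← Finset.sum_add_distrib]
  exact Finset.sum_congr rfl fun i _ => Finset.sum_congr rfl fun j _ => by ring

lemma sum_subtreeSum (w : ℕ → ℕ × ℕ → ℕ) (k N : ℕ) :
    ∑ c ∈ grid N, subtreeSum w k N c =
      ∑ l ∈ Finset.range k, ∑ c ∈ grid (2 ^ l * N), w (2 ^ l * N) c := by
  induction k generalizing N with
  | zero => simp [subtreeSum]
  | succ k ih =>
    simp only [subtreeSum, Finset.sum_add_distrib, sum_grid_childIndex, ih]
    rw [Finset.sum_range_succ', pow_zero, one_mul, add_comm]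
    simp only [pow_succ, mul_assoc]

lemma sum_filter_fiber {ι κ : Type*} [Fintype κ] [DecidableEq κ] (f : ι → κ) (s : Multiset ι) :
    ∑ b, s.filter (f · = b) = s := by
  classical
  ext a
  simp [Multiset.count_sum', Multiset.count_filter]

/-- The vertex `v` lies inside the circle `Q`. -/
def Hits {V : Type} (Q : Circle) (x : V → ℝ × ℝ) (v : V) : Prop := diskPolar (x v) ∈ Q.interior

open scoped Classical in
/-- Querying `T` for `Q` adds the vertices of `S` that lie inside `Q` to the output, each of them
once, in at most `B` steps. -/
def Reports {V : Type} (Q : Circle) (x : V → ℝ × ℝ) (T : QuadTree V) (S : Finset V) (B : ℕ) :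
    Prop :=
  ∀ acc : List V, ∃ (res : List V) (t : ℕ), (verticesInCircle Q T acc).Returns res t ∧
    (res : Multiset V) = acc + (S.filter (Hits Q x)).val ∧ t ≤ B

open scoped Classical in
/-- Indicator of the inner nodes that a query for `Q` expands, as a function of the grid cell. -/
def expanded {V : Type} [Fintype V] (α R : ℝ) (cap : ℕ) (x : V → ℝ × ℝ) (Q : Circle) (N : ℕ)
    (c : ℕ × ℕ) : ℕ :=
  if cap < (Finset.univ.filter fun v => x v ∈ (gridCell α R N c).region).card ∧
    ((gridCell α R N c).closedRegion ∩ Q.interior).Nonempty then 1 else 0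

section Query

variable {V : Type} {α R : ℝ} {cap : ℕ} {x : V → ℝ × ℝ} {Q : Circle} {N : ℕ} {c : ℕ × ℕ}
  {S : Finset V} {B : ℕ}

lemma Reports.mono {T : QuadTree V} {B' : ℕ} (h : Reports Q x T S B) (hB : B ≤ B') :
    Reports Q x T S B' := by
  intro acc
  obtain ⟨res, t, hret, hres, ht⟩ := h acc
  exact ⟨res, t, hret, hres, ht.trans hB⟩

open scoped Classical in
lemma scan_returns (pts : List (Item V)) (acc : List V) :
    ∃ res : List V, (scan Q pts acc).Returns res pts.length ∧ (res : Multiset V) =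
      acc + ((pts : Multiset (Item V)).filter fun p => (p.φ, p.r) ∈ Q.interior).map Item.id := by
  induction pts generalizing acc with
  | nil => exact ⟨acc, rfl, by simp⟩
  | cons p pts ih =>
    obtain ⟨res, hret, hres⟩ := ih (if polarDist p.φ p.r Q.φ Q.r < Q.rad then p.id :: acc else acc)
    refine ⟨res, ?_, ?_⟩
    · rw [scan, List.length_cons, add_comm]
      exact (Timed.returns_tick 1).bind hret
    · rw [hres, ← Multiset.cons_coe, Multiset.filter_cons]
      by_cases h : polarDist p.φ p.r Q.φ Q.r < Q.rad
      · simp [h, Circle.interior, ← Multiset.cons_coe]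
      · simp [h, Circle.interior]

lemma not_hits_of_rad_le (hα : 0 ≤ α) (hQ : Q.Central) (hc : c.1 < N)
    (h : Q.rad ≤ (gridCell α R N c).dist Q) {v : V} (hv : x v ∈ (gridCell α R N c).region) :
    ¬ Hits Q x v := fun hit =>
  (h.trans (gridCell_dist_le hc hQ (diskPolar_mem_closedRegion_gridCell hα hv))).not_gt hit

lemma reports_of_pruned (hα : 0 ≤ α) (hQ : Q.Central) (hc : c.1 < N) {T : QuadTree V}
    (hT : Stores α R cap x T N c S) (hS : ∀ v ∈ S, x v ∈ (gridCell α R N c).region)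
    (h : Q.rad ≤ (gridCell α R N c).dist Q) : Reports Q x T S 1 := by
  classical
  refine fun acc => ⟨acc, 1 + 0, ?_, ?_, le_rfl⟩
  · cases T <;> rw [verticesInCircle, hT.1, if_pos h] <;>
      exact (Timed.returns_tick 1).bind (Timed.returns_pure acc)
  · rw [Finset.filter_false_of_mem fun v hv => not_hits_of_rad_le hα hQ hc h (hS v hv),
      Finset.empty_val, add_zero]

lemma reports_leaf {cell : Cell} {pts : List (Item V)}
    (hT : Stores α R cap x (.leaf cell pts) N c S) (h : cell.dist Q < Q.rad) :
    Reports Q x (.leaf cell pts) S (cap + 1) := by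
  intro acc
  obtain ⟨res, hret, hres⟩ := scan_returns (Q := Q) pts acc
  refine ⟨res, 1 + pts.length, ?_, ?_, by have := hT.2.1; omega⟩
  · rw [verticesInCircle, if_neg h.not_ge]
    exact (Timed.returns_tick 1).bind hret
  · rw [hres, hT.2.2, Multiset.filter_map, Multiset.map_map, Finset.filter_val]
    exact congrArg _ (Multiset.map_id _)

lemma reports_node {cell : Cell} {child : Bool × Bool → QuadTree V} {B : Bool × Bool → ℕ}
    (f : V → Bool × Bool) (h : cell.dist Q < Q.rad)
    (hchild : ∀ q, Reports Q x (child q) (S.filter (f · = q)) (B q)) :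
    Reports Q x (.node cell child) S (1 + ∑ q, B q) := by
  classical
  intro acc
  obtain ⟨r₁, t₁, hret₁, hr₁, ht₁⟩ := hchild (false, false) acc
  obtain ⟨r₂, t₂, hret₂, hr₂, ht₂⟩ := hchild (false, true) r₁
  obtain ⟨r₃, t₃, hret₃, hr₃, ht₃⟩ := hchild (true, false) r₂
  obtain ⟨r₄, t₄, hret₄, hr₄, ht₄⟩ := hchild (true, true) r₃
  refine ⟨r₄, 1 + (t₁ + (t₂ + (t₃ + t₄))), ?_, ?_, ?_⟩
  · rw [verticesInCircle, if_neg h.not_ge]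
    exact (Timed.returns_tick 1).bind (hret₁.bind (hret₂.bind (hret₃.bind hret₄)))
  · rw [hr₄, hr₃, hr₂, hr₁, ← sum_filter_fiber f (S.filter (Hits Q x)).val,
      Fintype.sum_prod_type]
    simp only [Fintype.sum_bool, Finset.filter_val, Multiset.filter_comm (Hits Q x)]
    abel
  · simp only [Fintype.sum_prod_type, Fintype.sum_bool]
    omega

open scoped Classical in
lemma expanded_eq_one [Fintype V] (hα : 0 < α) (hR : 0 < R)
    (hS : ∀ v ∈ S, x v ∈ (gridCell α R N c).region) (hcard : cap < S.card)
    (h : (gridCell α R N c).dist Q < Q.rad) : expanded α R cap x Q N c = 1 :=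
  if_pos ⟨hcard.trans_le (Finset.card_le_card fun v hv =>
    Finset.mem_filter.2 ⟨Finset.mem_univ v, hS v hv⟩), gridCell_meets_interior_of_dist_lt hα hR h⟩

theorem reports_of_stores [Fintype V] (hα : 0 < α) (hR : 0 < R) (hcap : 1 ≤ cap) (hQ : Q.Central)
    {k : ℕ} (hsep : Separated α R x (N * 2 ^ k)) {T : QuadTree V}
    (hT : Stores α R cap x T N c S) (hc : c.1 < N)
    (hS : ∀ v ∈ S, x v ∈ (gridCell α R N c).region) :
    Reports Q x T S
      (cap + 1 + (4 * (cap + 1) + 1) * subtreeSum (expanded α R cap x Q) k N c) := by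
  induction k generalizing T N c S with
  | zero =>
    rw [pow_zero, mul_one] at hsep
    rcases le_or_gt Q.rad ((gridCell α R N c).dist Q) with hd | hd
    · exact (reports_of_pruned hα.le hQ hc hT hS hd).mono (by omega)
    cases T with
    | leaf cell pts =>
      exact (reports_leaf hT (hT.1 ▸ hd)).mono (by omega)
    | node cell child =>
      have := hT.2.1
      have := hsep.card_le_one hS
      omega
  | succ k ih =>
    rw [pow_succ', ← mul_assoc, mul_comm N] at hsep
    rcases le_or_gt Q.rad ((gridCell α R N c).dist Q) with hd | hd
    · exact (reports_of_pruned hα.le hQ hc hT hS hd).mono (by omega)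
    cases T with
    | leaf cell pts =>
      exact (reports_leaf hT (hT.1 ▸ hd)).mono (by omega)
    | node cell child =>
      obtain ⟨rfl, hcard, hchild⟩ := hT
      refine (reports_node _ hd fun q => ih hsep (hchild q) ?_
        (mem_child_region hα hS q)).mono ?_
      · have := Bool.toNat_le q.1
        simp only [childIndex]
        omega
      · rw [subtreeSum, expanded_eq_one hα hR hS hcard hd]
        simp only [Finset.sum_add_distrib, ← Finset.mul_sum, Finset.sum_const, Finset.card_univ,
          Fintype.card_prod, Fintype.card_bool, smul_eq_mul]
        linarith

end Query

open scoped Classical in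
/-- The vertices inside the circle `Q`. -/
def hits {V : Type} [Fintype V] (Q : Circle) (x : V → ℝ × ℝ) : Finset V :=
  Finset.univ.filter (Hits Q x)

/-- Bound for the cost of a query for `Q` in a quadtree whose cells at depth `k` are separated. -/
def queryCost {V : Type} [Fintype V] (α R : ℝ) (cap k : ℕ) (x : V → ℝ × ℝ) (Q : Circle) : ℕ :=
  cap + 1 + (4 * (cap + 1) + 1) * subtreeSum (expanded α R cap x Q) k 1 (0, 0)

/-! ### The generator -/

section EdgeLoop

variable {V : Type} [DecidableEq V]

lemma addEdges_returns (v : V) (ws : List V) (E : List (V × V)) : ∃ E',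
    (addEdges v ws E).Returns E' ws.length ∧
    ∀ a b, (a, b) ∈ E' ↔ (a, b) ∈ E ∨ (a = v ∧ b ∈ ws ∧ a ≠ b) := by
  induction ws generalizing E with
  | nil => exact ⟨E, rfl, by simp⟩
  | cons w ws ih =>
    obtain ⟨E', hret, hE'⟩ := ih (if w = v then E else (v, w) :: E)
    refine ⟨E', ?_, fun a b => ?_⟩
    · rw [addEdges, List.length_cons, add_comm]
      exact (Timed.returns_tick 1).bind hret
    · rw [hE']
      split_ifs with hw
      · aesop
      · aesop

lemma edgeLoop_returns [Fintype V] {R : ℝ} {x : V → ℝ × ℝ} {T : QuadTree V} {B : V → ℕ}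
    (hT : ∀ v, Reports (queryCircle R (x v)) x T Finset.univ (B v)) (vs : List V)
    (E : List (V × V)) : ∃ E' t, (edgeLoop R T x vs E).Returns E' t ∧
      (∀ a b, (a, b) ∈ E' ↔ (a, b) ∈ E ∨ (a ∈ vs ∧ a ≠ b ∧ Hits (queryCircle R (x a)) x b)) ∧
      t ≤ (vs.map fun v => 1 + B v + (hits (queryCircle R (x v)) x).card).sum := by
  induction vs generalizing E with
  | nil => exact ⟨E, 0, rfl, by simp, by simp⟩
  | cons v vs ih =>
    obtain ⟨ws, t₁, hret₁, hws, ht₁⟩ := hT v []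
    rw [Multiset.coe_nil, zero_add] at hws
    have hmem : ∀ b, b ∈ ws ↔ Hits (queryCircle R (x v)) x b := fun b => by
      rw [← Multiset.mem_coe, hws]
      simp
    have hlen : ws.length = (hits (queryCircle R (x v)) x).card := by
      rw [← Multiset.coe_card, hws, Finset.card_val, hits]
    obtain ⟨E₁, hret₂, hE₁⟩ := addEdges_returns v ws E
    obtain ⟨E₂, t₂, hret₃, hE₂, ht₂⟩ := ih E₁
    refine ⟨E₂, 1 + (t₁ + (ws.length + t₂)), ?_, fun a b => ?_, ?_⟩
    · rw [edgeLoop]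
      exact (Timed.returns_tick 1).bind (hret₁.bind (hret₂.bind hret₃))
    · rw [hE₂, hE₁, List.mem_cons, hmem]
      aesop
    · rw [List.map_cons, List.sum_cons]
      omega

end EdgeLoop

lemma lt_targetRadius (n : ℕ) (k α ε : ℝ) (rounds : ℕ) {lo hi : ℝ} (h : lo < hi) :
    lo < (targetRadius n k α ε rounds lo hi).1 := by
  induction rounds generalizing lo hi with
  | zero => exact left_lt_add_div_two.2 h
  | succ m ih =>
    simp only [targetRadius]
    split_ifs
    · exact left_lt_add_div_two.2 h
    · exact ih (left_lt_add_div_two.2 h)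
    · exact (left_lt_add_div_two.2 h).trans (ih (add_div_two_lt_right.2 h))

lemma targetRadius_cost_le (n : ℕ) (k α ε : ℝ) (rounds : ℕ) (lo hi : ℝ) :
    (targetRadius n k α ε rounds lo hi).2 ≤ rounds + 1 := by
  induction rounds generalizing lo hi with
  | zero => exact le_rfl
  | succ m ih =>
    simp only [targetRadius]
    split_ifs
    · exact Nat.le_add_left _ _
    · exact Nat.succ_le_succ (ih _ _)
    · exact Nat.succ_le_succ (ih _ _)

lemma queryCircle_central_of_mem_root {α R : ℝ} (hα : 0 < α) (hR : 0 ≤ R) {p : ℝ × ℝ}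
    (hp : p ∈ (gridCell α R 1 (0, 0)).region) : (queryCircle R p).Central := by
  rw [gridCell_one hα hR] at hp
  exact queryCircle_central hp.1 hp.2

theorem generate_returns {cap n : ℕ} {k α lo hi ε : ℝ} {rounds : ℕ} {x : Fin n → ℝ × ℝ}
    (hcap : 1 ≤ cap) (hα : 0 < α) (hrounds : rounds ≤ n) {R : ℝ} (hR : 0 < R)
    (hRdef : R = (targetRadius n k α ε rounds lo hi).1) {m : ℕ}
    (hsep : Separated α R x (2 ^ m)) (hx : ∀ v, x v ∈ (gridCell α R 1 (0, 0)).region) :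
    ∃ E t, (∀ depth, 2 * m + 1 ≤ depth →
        (generate cap n k α lo hi ε rounds x depth).Returns E t) ∧
      (∀ v w, (v, w) ∈ E ↔ (hyperbolicGraph R x).Adj v w) ∧
      t ≤ n + 1 + n * ((m + 1) * (5 * (cap + 1) + 1) + 1) +
        ∑ v, (1 + queryCost α R cap m x (queryCircle R (x v)) +
          (hits (queryCircle R (x v)) x).card) := by
  have hQ := fun v => queryCircle_central_of_mem_root hα hR.le (hx v)
  have hempty : Stores α R cap x (.leaf ⟨0, 2 * Real.pi, 0, R⟩ []) 1 (0, 0) ∅ :=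
    ⟨(gridCell_one hα hR.le).symm, Nat.zero_le _, rfl⟩
  obtain ⟨T, t₁, hret₁, hT, ht₁⟩ := insertLoop_stores (S' := Finset.univ) (vs := List.finRange n)
    hα hcap hsep hx hempty (zero_add _).symm
  have hquery : ∀ v, Reports (queryCircle R (x v)) x T Finset.univ
      (queryCost α R cap m x (queryCircle R (x v))) := fun v =>
    reports_of_stores hα hR hcap (hQ v) (by rwa [one_mul]) hT one_pos fun w _ => hx w
  obtain ⟨E, t₂, hret₂, hE, ht₂⟩ := edgeLoop_returns hquery (List.finRange n) []
  refine ⟨E, (targetRadius n k α ε rounds lo hi).2 + (t₁ + t₂), fun depth hd => ?_,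
    fun v w => ?_, ?_⟩
  · rw [generate]
    refine (Timed.returns_tick _).bind ?_
    rw [← hRdef]
    exact (hret₁ depth hd).bind hret₂
  · rw [hE]
    simp only [List.not_mem_nil, false_or, List.mem_finRange, true_and]
    exact and_congr_right fun _ => (hypDist_lt_iff hR (hQ v).rad_pos (x w)).symm
  · have := targetRadius_cost_le n k α ε rounds lo hi
    rw [List.length_finRange] at ht₁
    rw [Fin.sum_univ_def]
    omega

/-! ### Counting expanded nodes -/

open scoped Classical in
/-- The vertices in the cells of the `N × N` grid that the circle `Q` straddles. -/
def straddlingVertices {V : Type} [Fintype V] (α R : ℝ) (N : ℕ) (Q : Circle) (x : V → ℝ × ℝ) :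
    Finset V :=
  Finset.univ.filter fun v => ∃ c ∈ straddlingCells α R N Q, x v ∈ (gridCell α R N c).region

section Counting

variable {V : Type} {α R : ℝ} {cap : ℕ} {x : V → ℝ × ℝ} {Q : Circle}

lemma card_le_card_of_occupied (hα : 0 < α) (hR : 0 < R) {N : ℕ} {C : Finset (ℕ × ℕ)}
    {S : Finset V} (h : ∀ c ∈ C, ∃ v ∈ S, x v ∈ (gridCell α R N c).region) : C.card ≤ S.card :=
  Finset.card_le_card_of_forall_subsingleton (fun c v => x v ∈ (gridCell α R N c).region) h
    fun _ _ _ hc _ hc' => gridCell_index_eq hα hR hc.2 hc'.2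

variable [Fintype V]

open scoped Classical in
/-- An expanded cell without a vertex inside the circle straddles the circle. -/
lemma sum_expanded_le (hα : 0 < α) (hR : 0 < R) (N : ℕ) :
    ∑ c ∈ grid N, expanded α R cap x Q N c ≤ (hits Q x).card +
      ((straddlingCells α R N Q).filter fun c => ∃ v, x v ∈ (gridCell α R N c).region).card := by
  simp only [expanded]
  rw [← Finset.card_filter]
  set A := (grid N).filter fun c => ∃ v ∈ hits Q x, x v ∈ (gridCell α R N c).region
  have hA : A.card ≤ (hits Q x).card :=
    card_le_card_of_occupied hα hR fun c hc => (Finset.mem_filter.1 hc).2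
  refine (Finset.card_le_card fun c hc => ?_).trans
    ((Finset.card_union_le A _).trans (Nat.add_le_add_right hA _))
  obtain ⟨hgrid, hcard, hmeets⟩ := Finset.mem_filter.1 hc
  obtain ⟨v, hv⟩ := Finset.card_pos.1 (Nat.zero_lt_of_lt hcard)
  have hv := (Finset.mem_filter.1 hv).2
  rw [Finset.mem_union]
  by_cases hit : Hits Q x v
  · exact Or.inl (Finset.mem_filter.2
      ⟨hgrid, v, Finset.mem_filter.2 ⟨Finset.mem_univ v, hit⟩, hv⟩)
  · exact Or.inr (Finset.mem_filter.2 ⟨Finset.mem_filter.2 ⟨hgrid, hmeets, fun hsub =>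
      hit (hsub (diskPolar_mem_closedRegion_gridCell hα.le hv))⟩, v, hv⟩)

open scoped Classical in
/-- On coarse levels there are few straddling cells, on fine levels few vertices in them. -/
lemma card_occupied_straddlingCells_le (hα : 0 < α) (hR : 0 < R) (hQ : Q.Central) (l m : ℕ) :
    ((straddlingCells α R (2 ^ l) Q).filter fun c =>
        ∃ v, x v ∈ (gridCell α R (2 ^ l) c).region).card ≤
      9 * 2 ^ m + (straddlingVertices α R (2 ^ m) Q x).card := by
  rcases le_total l m with h | h
  · have hpow : 2 ^ l ≤ 2 ^ m := Nat.pow_le_pow_right two_pos h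
    have hcells := card_straddlingCells_le hα hR hQ (N := 2 ^ l) (by positivity)
    exact (Finset.card_filter_le _ _).trans (by omega)
  · obtain ⟨e, rfl⟩ := Nat.exists_eq_add_of_le h
    have he : 0 < 2 ^ e := by positivity
    rw [pow_add]
    refine (card_le_card_of_occupied (N := 2 ^ m * 2 ^ e) (x := x) hα hR fun c hc => ?_).trans
      (Nat.le_add_left _ _)
    obtain ⟨hstr, v, hv⟩ := Finset.mem_filter.1 hc
    obtain ⟨hgrid, hstr⟩ := Finset.mem_filter.1 hstr
    exact ⟨v, Finset.mem_filter.2 ⟨Finset.mem_univ v, ancestorIndex (2 ^ e) c,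
      Finset.mem_filter.2 ⟨ancestorIndex_mem_grid hgrid, hstr.ancestor hα hR he⟩,
      region_subset_ancestor hα hR he hv⟩, hv⟩

lemma subtreeSum_expanded_le (hα : 0 < α) (hR : 0 < R) (hQ : Q.Central) (k m : ℕ) :
    subtreeSum (expanded α R cap x Q) k 1 (0, 0) ≤
      k * ((hits Q x).card + (9 * 2 ^ m + (straddlingVertices α R (2 ^ m) Q x).card)) := by
  have hroot : ∑ c ∈ grid 1, subtreeSum (expanded α R cap x Q) k 1 c =
      subtreeSum (expanded α R cap x Q) k 1 (0, 0) := Finset.sum_singleton _ _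
  rw [← hroot, sum_subtreeSum, ← smul_eq_mul k]
  nth_rw 2 [← Finset.card_range k]
  refine Finset.sum_le_card_nsmul _ _ _ fun l _ => ?_
  rw [mul_one]
  exact (sum_expanded_le hα hR (2 ^ l)).trans
    (Nat.add_le_add_left (card_occupied_straddlingCells_le hα hR hQ l m) _)

lemma one_add_queryCost_add_card_hits_le (hα : 0 < α) (hR : 0 < R) (hQ : Q.Central) (k : ℕ)
    {m K : ℕ} (hK : (straddlingVertices α R (2 ^ m) Q x).card ≤ K) :
    1 + queryCost α R cap k x Q + (hits Q x).card ≤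
      (cap + 1) * (k + 1) * (2 + 6 * (hits Q x).card + 5 * (9 * 2 ^ m + K)) := by
  have hsum := subtreeSum_expanded_le (cap := cap) (x := x) hα hR hQ k m
  set h := (hits Q x).card
  set W := 9 * 2 ^ m + K
  have hsum' : subtreeSum (expanded α R cap x Q) k 1 (0, 0) ≤ k * (h + W) :=
    hsum.trans (Nat.mul_le_mul_left _ (by omega))
  have hD : cap + 1 ≤ (cap + 1) * (k + 1) := Nat.le_mul_of_pos_right _ k.succ_pos
  calc 1 + queryCost α R cap k x Q + h
      ≤ 1 + (cap + 1 + (4 * (cap + 1) + 1) * (k * (h + W))) + h := by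
        unfold queryCost
        gcongr
    _ ≤ 1 + (cap + 1 + 5 * (cap + 1) * ((k + 1) * (h + W))) + h := by
        gcongr <;> omega
    _ ≤ (cap + 1) * (k + 1) + ((cap + 1) * (k + 1) + 5 * (cap + 1) * ((k + 1) * (h + W))) +
          (cap + 1) * (k + 1) * h := by
        gcongr
        · omega
        · exact Nat.le_mul_of_pos_left h (by positivity)
    _ = (cap + 1) * (k + 1) * (2 + 6 * h + 5 * W) := by ring

lemma sum_card_hits_le (hα : 0 < α) (hR : 0 < R) {n : ℕ} {x : Fin n → ℝ × ℝ}
    (hx : ∀ v, x v ∈ (gridCell α R 1 (0, 0)).region) :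
    ∑ v, (hits (queryCircle R (x v)) x).card ≤ n + 2 * (hyperbolicGraph R x).edgeSet.ncard := by
  classical
  set G := hyperbolicGraph R x
  have hdeg : ∀ v, (hits (queryCircle R (x v)) x).card ≤ 1 + G.degree v := by
    intro v
    rw [add_comm, ← SimpleGraph.card_neighborFinset_eq_degree]
    refine (Finset.card_le_card fun w hw => ?_).trans (Finset.card_insert_le v _)
    rw [Finset.mem_insert, SimpleGraph.mem_neighborFinset, or_iff_not_imp_left]
    exact fun hvw => ⟨Ne.symm hvw, (hypDist_lt_iff hR
      (queryCircle_central_of_mem_root hα hR.le (hx v)).rad_pos (x w)).2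
      (Finset.mem_filter.1 hw).2⟩
  calc _ ≤ ∑ v, (1 + G.degree v) := Finset.sum_le_sum fun v _ => hdeg v
    _ = n + 2 * G.edgeSet.ncard := by
      rw [Finset.sum_add_distrib, G.sum_degrees_eq_twice_card_edges,
        ← SimpleGraph.coe_edgeFinset, Set.ncard_coe_finset, Fin.sum_const, smul_eq_mul, mul_one]

theorem total_steps_le (hα : 0 < α) (hR : 0 < R) {n l : ℕ} (k : ℕ) (hn : 1 ≤ n)
    {x : Fin n → ℝ × ℝ} (hx : ∀ v, x v ∈ (gridCell α R 1 (0, 0)).region)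
    (hstr : ∀ v, (straddlingVertices α R (2 ^ l) (queryCircle R (x v)) x).card ≤ 216 * 2 ^ l) :
    n + 1 + n * ((k + 1) * (5 * (cap + 1) + 1) + 1) +
        ∑ v, (1 + queryCost α R cap k x (queryCircle R (x v)) +
          (hits (queryCircle R (x v)) x).card) ≤
      1142 * (cap + 1) * (k + 1) * (2 ^ l * n + (hyperbolicGraph R x).edgeSet.ncard) := by
  have hhits := sum_card_hits_le hα hR hx
  set m := (hyperbolicGraph R x).edgeSet.ncard
  set D := (cap + 1) * (k + 1)
  have hquery : ∑ v, (1 + queryCost α R cap k x (queryCircle R (x v)) +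
      (hits (queryCircle R (x v)) x).card) ≤ D * (8 * n + 12 * m + 1125 * (2 ^ l * n)) := by
    calc _ ≤ ∑ v, D * (2 + 6 * (hits (queryCircle R (x v)) x).card + 5 * (225 * 2 ^ l)) :=
          Finset.sum_le_sum fun v _ => (one_add_queryCost_add_card_hits_le hα hR
            (queryCircle_central_of_mem_root hα hR.le (hx v)) k (hstr v)).trans_eq (by ring)
      _ = D * (2 * n + 6 * ∑ v, (hits (queryCircle R (x v)) x).card + 1125 * (2 ^ l * n)) := by
          rw [← Finset.mul_sum, Finset.sum_add_distrib, Finset.sum_add_distrib, ← Finset.mul_sum,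
            Fin.sum_const, Fin.sum_const, smul_eq_mul, smul_eq_mul]
          ring
      _ ≤ _ := Nat.mul_le_mul_left D (by omega)
  have hinsert : n + 1 + n * ((k + 1) * (5 * (cap + 1) + 1) + 1) ≤ D * (9 * n) := by
    calc _ ≤ n + n + n * ((k + 1) * (6 * (cap + 1)) + 1) := by
          gcongr
          omega
      _ = n * 3 + D * (6 * n) := by ring
      _ ≤ n * (3 * D) + D * (6 * n) := by
          gcongr
          exact Nat.le_mul_of_pos_right 3 (by positivity)
      _ = D * (9 * n) := by ring
  have hn' : n ≤ 2 ^ l * n := Nat.le_mul_of_pos_left n (by positivity)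
  calc _ ≤ D * (9 * n) + D * (8 * n + 12 * m + 1125 * (2 ^ l * n)) := add_le_add hinsert hquery
    _ = D * (17 * n + 12 * m + 1125 * (2 ^ l * n)) := by ring
    _ ≤ D * (1142 * (2 ^ l * n + m)) := Nat.mul_le_mul_left D (by omega)
    _ = _ := by ring

end Counting

/-! ### Independent samples -/

section IndependentSamples

variable {ι X : Type*} [Fintype ι] [MeasurableSpace X] {μ : Measure X} [IsProbabilityMeasure μ]

lemma measure_pi_mem_and_forall_mem {v : ι} {S : Finset ι} (hv : v ∉ S) (s t : Set X) :
    Measure.pi (fun _ : ι => μ) {x | x v ∈ s ∧ ∀ w ∈ S, x w ∈ t} = μ s * μ t ^ S.card := by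
  classical
  set f : ι → Set X := Function.update (fun _ => t) v s
  have hfv : f v = s := Function.update_self ..
  have hfS : ∀ w ∈ S, f w = t := fun w hw => Function.update_of_ne (ne_of_mem_of_not_mem hw hv) ..
  have hpi : {x : ι → X | x v ∈ s ∧ ∀ w ∈ S, x w ∈ t} = Set.pi (Finset.cons v S hv) f := by
    ext x
    rw [Set.mem_pi, Finset.coe_cons, Set.forall_mem_insert, hfv]
    exact and_congr_right fun _ => forall₂_congr fun w hw => by rw [hfS w hw]
  rw [hpi, Measure.pi_pi_finset, Finset.prod_cons, hfv,
    Finset.prod_congr rfl fun w hw => by rw [hfS w hw], Finset.prod_const]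

section Fibers

variable {β : Type*} [Countable β] {F : X → β} {A : β → Set X} {b : ENNReal}

/-- Conditionally on the value of `F` at one sample, the other samples are still independent. -/
lemma measure_pi_forall_mem_le (hF : ∀ s, MeasurableSet (F ⁻¹' {s}))
    (hA : ∀ᵐ y ∂μ, μ (A (F y)) ≤ b) {v : ι} {S : Finset ι} (hv : v ∉ S) :
    Measure.pi (fun _ : ι => μ) {x | ∀ w ∈ S, x w ∈ A (F (x v))} ≤ b ^ S.card := by
  set P := Measure.pi fun _ : ι => μ
  have hfiber : ∀ s, P {x | x v ∈ F ⁻¹' {s} ∧ ∀ w ∈ S, x w ∈ A s} ≤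
      μ (F ⁻¹' {s}) * b ^ S.card := by
    intro s
    rw [measure_pi_mem_and_forall_mem hv]
    by_cases hs : μ (F ⁻¹' {s}) = 0
    · rw [hs, zero_mul, zero_mul]
    · obtain ⟨y, rfl, hy⟩ := ((frequently_ae_mem_iff.2 hs).and_eventually hA).exists
      gcongr
  calc P {x | ∀ w ∈ S, x w ∈ A (F (x v))}
      ≤ P (⋃ s, {x | x v ∈ F ⁻¹' {s} ∧ ∀ w ∈ S, x w ∈ A s}) :=
        measure_mono fun x hx => Set.mem_iUnion.2 ⟨F (x v), rfl, hx⟩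
    _ ≤ ∑' s, μ (F ⁻¹' {s}) * b ^ S.card :=
        (measure_iUnion_le _).trans (ENNReal.tsum_le_tsum hfiber)
    _ = b ^ S.card := by
        rw [ENNReal.tsum_mul_right, ← tsum_univ fun s => μ (F ⁻¹' {s}),
          tsum_measure_preimage_singleton Set.countable_univ fun s _ => hF s, Set.preimage_univ,
          measure_univ, one_mul]

open scoped Classical in
theorem measure_pi_exists_lt_card_le (hF : ∀ s, MeasurableSet (F ⁻¹' {s}))
    (hA : ∀ᵐ y ∂μ, μ (A (F y)) ≤ b) (K : ℕ) :
    Measure.pi (fun _ : ι => μ)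
        {x | ∃ v, K < (Finset.univ.filter fun w => x w ∈ A (F (x v))).card} ≤
      Fintype.card ι * ((Fintype.card ι).choose K * b ^ K) := by
  set P := Measure.pi fun _ : ι => μ
  calc _ ≤ P (⋃ v ∈ (Finset.univ : Finset ι), ⋃ S ∈ (Finset.univ.erase v).powersetCard K,
        {x | ∀ w ∈ S, x w ∈ A (F (x v))}) := by
        refine measure_mono ?_
        rintro x ⟨v, hv⟩
        obtain ⟨S, hS, hcard⟩ := Finset.exists_subset_card_eq
          ((Nat.le_sub_one_of_lt hv).trans (Finset.pred_card_le_card_erase (a := v)))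
        refine Set.mem_biUnion (Finset.mem_coe.2 (Finset.mem_univ v))
          (Set.mem_biUnion (Finset.mem_coe.2 (Finset.mem_powersetCard.2
            ⟨hS.trans (Finset.erase_subset_erase v (Finset.subset_univ _)), hcard⟩)) ?_)
        exact fun w hw => (Finset.mem_filter.1 (Finset.mem_of_mem_erase (hS hw))).2
    _ ≤ ∑ v : ι, ∑ _ ∈ (Finset.univ.erase v).powersetCard K, b ^ K := by
        refine (measure_biUnion_finset_le _ _).trans (Finset.sum_le_sum fun v _ => ?_)
        refine (measure_biUnion_finset_le _ _).trans (Finset.sum_le_sum fun S hS => ?_)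
        obtain ⟨hsub, rfl⟩ := Finset.mem_powersetCard.1 hS
        exact measure_pi_forall_mem_le hF hA fun hv => Finset.notMem_erase v _ (hsub hv)
    _ ≤ ∑ _ : ι, ((Fintype.card ι).choose K * b ^ K) := by
        refine Finset.sum_le_sum fun _ _ => ?_
        rw [Finset.sum_const, Finset.card_powersetCard, nsmul_eq_mul]
        gcongr
        exact Finset.card_le_univ _
    _ = Fintype.card ι * ((Fintype.card ι).choose K * b ^ K) := by
        rw [Finset.sum_const, Finset.card_univ, nsmul_eq_mul]

end Fibers

lemma measure_pi_exists_collision_le {κ : Type*} (U : Finset κ) (A : κ → Set X) :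
    Measure.pi (fun _ : ι => μ) {x | ∃ c ∈ U, ∃ v w, v ≠ w ∧ x v ∈ A c ∧ x w ∈ A c} ≤
      Fintype.card ι ^ 2 * ∑ c ∈ U, μ (A c) ^ 2 := by
  set P := Measure.pi fun _ : ι => μ
  have hpair : ∀ c, ∀ v w : ι, P {x | v ≠ w ∧ x v ∈ A c ∧ x w ∈ A c} ≤ μ (A c) ^ 2 := by
    intro c v w
    by_cases hvw : v = w
    · simp [hvw]
    · have hpair := measure_pi_mem_and_forall_mem (μ := μ) (Finset.notMem_singleton.2 hvw)
        (A c) (A c)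
      rw [Finset.card_singleton, pow_one, ← sq] at hpair
      refine (measure_mono ?_).trans hpair.le
      exact fun x hx => ⟨hx.2.1, by simpa using hx.2.2⟩
  calc _ ≤ P (⋃ c ∈ U, ⋃ v ∈ (Finset.univ : Finset ι), ⋃ w ∈ (Finset.univ : Finset ι),
        {x | v ≠ w ∧ x v ∈ A c ∧ x w ∈ A c}) := by
        refine measure_mono ?_
        rintro x ⟨c, hc, v, w, h⟩
        exact Set.mem_biUnion (Finset.mem_coe.2 hc) (Set.mem_biUnion (Finset.mem_coe.2
          (Finset.mem_univ v)) (Set.mem_biUnion (Finset.mem_coe.2 (Finset.mem_univ w)) h))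
    _ ≤ ∑ c ∈ U, ∑ v : ι, ∑ w : ι, μ (A c) ^ 2 := by
        refine (measure_biUnion_finset_le _ _).trans (Finset.sum_le_sum fun c _ => ?_)
        refine (measure_biUnion_finset_le _ _).trans (Finset.sum_le_sum fun _ _ => ?_)
        exact (measure_biUnion_finset_le _ _).trans (Finset.sum_le_sum fun _ _ => hpair c _ _)
    _ = Fintype.card ι ^ 2 * ∑ c ∈ U, μ (A c) ^ 2 := by
        simp only [Finset.sum_const, Finset.card_univ, nsmul_eq_mul]
        rw [← Finset.mul_sum, ← Finset.mul_sum, ← mul_assoc, sq]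

end IndependentSamples

/-! ### The law of a position -/

lemma withDensity_restrict_univ {X : Type*} [MeasurableSpace X] (μ : Measure X) {s : Set X}
    (hs : MeasurableSet s) (f : X → ENNReal) :
    (μ.restrict s).withDensity f Set.univ = (μ.restrict s).withDensity f s := by
  rw [← restrict_withDensity hs, Measure.restrict_apply_univ, Measure.restrict_apply_self]

/-- The law of the native polar coordinates of a single vertex. -/
def positionLaw (α R : ℝ) : Measure (ℝ × ℝ) := angleLaw.prod (radialLaw α R)

lemma angleLaw_Ico {a b : ℝ} (ha : 0 ≤ a) (hb : b ≤ 2 * Real.pi) :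
    angleLaw (Set.Ico a b) = ENNReal.ofReal ((b - a) / (2 * Real.pi)) := by
  rw [angleLaw, withDensity_const, Measure.smul_apply, Measure.restrict_apply measurableSet_Ico,
    Set.inter_eq_left.2 (Set.Ico_subset_Ico ha hb), Real.volume_Ico, smul_eq_mul,
    ← ENNReal.ofReal_mul (by positivity), one_div_mul_eq_div]

instance : IsProbabilityMeasure angleLaw where
  measure_univ := by
    rw [angleLaw, withDensity_restrict_univ _ measurableSet_Ico, ← angleLaw,
      angleLaw_Ico le_rfl le_rfl, sub_zero, div_self Real.two_pi_pos.ne', ENNReal.ofReal_one]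

section PositionLaw

variable {α R : ℝ}

lemma cosh_mul_sub_one_pos (hα : 0 < α) (hR : 0 < R) : 0 < Real.cosh (α * R) - 1 :=
  sub_pos.2 (Real.one_lt_cosh.2 (mul_pos hα hR).ne')

lemma radialLaw_Ico (hα : 0 < α) (hR : 0 < R) {a b : ℝ} (ha : 0 ≤ a) (hab : a ≤ b) (hb : b ≤ R) :
    radialLaw α R (Set.Ico a b) = ENNReal.ofReal
      ((Real.cosh (α * b) - Real.cosh (α * a)) / (Real.cosh (α * R) - 1)) := by
  have hcosh := cosh_mul_sub_one_pos hα hR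
  set f : ℝ → ℝ := fun r => α * Real.sinh (α * r) / (Real.cosh (α * R) - 1)
  have hf : Continuous f := by fun_prop
  have hnonneg : ∀ r ∈ Set.Ico a b, 0 ≤ f r := fun r hr => div_nonneg (mul_nonneg hα.le
    (Real.sinh_nonneg_iff.2 (mul_nonneg hα.le (ha.trans hr.1)))) hcosh.le
  have hderiv : ∀ r, HasDerivAt (fun r => Real.cosh (α * r) / (Real.cosh (α * R) - 1)) (f r) r := by
    intro r
    have h := ((hasDerivAt_id r).const_mul α).cosh.div_const (Real.cosh (α * R) - 1)
    simpa only [id, mul_one, mul_comm (Real.sinh _)] using h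
  rw [radialLaw, withDensity_apply _ measurableSet_Ico,
    Measure.restrict_restrict measurableSet_Ico,
    Set.inter_eq_left.2 (Set.Ico_subset_Ico ha hb), ← ofReal_integral_eq_lintegral_ofReal
      ((hf.integrableOn_Icc (a := a) (b := b)).mono_set Set.Ico_subset_Icc_self)
      ((ae_restrict_mem measurableSet_Ico).mono hnonneg),
    integral_Ico_eq_integral_Ioc, ← intervalIntegral.integral_of_le hab,
    intervalIntegral.integral_eq_sub_of_hasDerivAt (fun r _ => hderiv r)
      (hf.intervalIntegrable _ _), sub_div]

lemma isProbabilityMeasure_radialLaw (hα : 0 < α) (hR : 0 < R) :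
    IsProbabilityMeasure (radialLaw α R) where
  measure_univ := by
    rw [radialLaw, withDensity_restrict_univ _ measurableSet_Ico, ← radialLaw,
      radialLaw_Ico hα hR le_rfl hR.le le_rfl, mul_zero, Real.cosh_zero,
      div_self (cosh_mul_sub_one_pos hα hR).ne', ENNReal.ofReal_one]

lemma isProbabilityMeasure_positionLaw (hα : 0 < α) (hR : 0 < R) :
    IsProbabilityMeasure (positionLaw α R) := by
  have := isProbabilityMeasure_radialLaw hα hR
  unfold positionLaw
  infer_instance

lemma isProbabilityMeasure_vertexLaw (hα : 0 < α) (hR : 0 < R) (n : ℕ) :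
    IsProbabilityMeasure (vertexLaw n α R) := by
  have := isProbabilityMeasure_positionLaw hα hR
  exact inferInstanceAs (IsProbabilityMeasure (Measure.pi fun _ : Fin n => positionLaw α R))

lemma measurableSet_region (c : Cell) : MeasurableSet c.region :=
  measurableSet_Ico.prod measurableSet_Ico

theorem positionLaw_gridCell (hα : 0 < α) (hR : 0 < R) {N : ℕ} {c : ℕ × ℕ} (hc : c ∈ grid N) :
    positionLaw α R (gridCell α R N c).region = ENNReal.ofReal (1 / (N : ℝ) ^ 2) := by
  have := isProbabilityMeasure_radialLaw hα hR
  obtain ⟨hc₁, hc₂⟩ := Finset.mem_product.1 hc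
  have hN : (0 : ℝ) < N := by exact_mod_cast (Nat.zero_le _).trans_lt (Finset.mem_range.1 hc₁)
  have hle : ∀ i ∈ Finset.range N, ((i : ℝ) + 1) / N ≤ 1 := fun i hi => by
    rw [div_le_one hN]
    exact_mod_cast Finset.mem_range.1 hi
  have hj₀ : (0 : ℝ) ≤ c.2 / N := by positivity
  have hj₁ : (0 : ℝ) ≤ ((c.2 : ℝ) + 1) / N := by positivity
  have hj : (c.2 : ℝ) / N ≤ ((c.2 : ℝ) + 1) / N := by gcongr; linarith
  have hmono := (strictMonoOn_radialQuantile hα hR).monotoneOn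
  have hlast : radialQuantile α R (((c.2 : ℝ) + 1) / N) ≤ R :=
    (hmono hj₁ (Set.mem_Ici.2 zero_le_one) (hle _ hc₂)).trans_eq (radialQuantile_one hα hR.le)
  have hangle : angleLaw (Set.Ico (2 * Real.pi * (c.1 / N)) (2 * Real.pi * ((c.1 + 1) / N))) =
      ENNReal.ofReal (1 / N) := by
    rw [angleLaw_Ico (by positivity) (mul_le_of_le_one_right Real.two_pi_pos.le (hle _ hc₁)),
      ← mul_sub, mul_div_cancel_left₀ _ Real.two_pi_pos.ne', ← sub_div, add_sub_cancel_left]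
  have hradius : radialLaw α R (Set.Ico (radialQuantile α R (c.2 / N))
      (radialQuantile α R ((c.2 + 1) / N))) = ENNReal.ofReal (1 / N) := by
    rw [radialLaw_Ico hα hR (radialQuantile_nonneg hα.le hj₀) (hmono hj₀ hj₁ hj) hlast,
      cosh_radialQuantile hα.ne' hj₀, cosh_radialQuantile hα.ne' hj₁, add_sub_add_left_eq_sub,
      ← mul_sub, mul_div_cancel_left₀ _ (cosh_mul_sub_one_pos hα hR).ne', ← sub_div,
      add_sub_cancel_left]
  refine (Measure.prod_prod _ _).trans ((congrArg₂ _ hangle hradius).trans ?_)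
  rw [← ENNReal.ofReal_mul (by positivity), one_div_mul_one_div, sq]

lemma ae_mem_root (hα : 0 < α) (hR : 0 < R) :
    ∀ᵐ p ∂positionLaw α R, p ∈ (gridCell α R 1 (0, 0)).region := by
  have := isProbabilityMeasure_positionLaw hα hR
  refine (mem_ae_iff_prob_eq_one (measurableSet_region _)).2 ?_
  rw [positionLaw_gridCell hα hR (by simp [grid]), Nat.cast_one, one_pow, div_one,
    ENNReal.ofReal_one]

end PositionLaw

/-! ### Measurability of the set of straddling cells -/

lemma isOpen_setOf_inter_nonempty {X Y : Type*} [TopologicalSpace X] [TopologicalSpace Y]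
    {U : Set (X × Y)} (hU : IsOpen U) (K : Set Y) :
    IsOpen {x | (K ∩ {y | (x, y) ∈ U}).Nonempty} := by
  have : {x | (K ∩ {y | (x, y) ∈ U}).Nonempty} = ⋃ y ∈ K, {x | (x, y) ∈ U} := by
    ext x
    simp [Set.Nonempty]
  rw [this]
  exact isOpen_biUnion fun y _ => hU.preimage (by fun_prop)

lemma isOpen_setOf_subset {X Y : Type*} [TopologicalSpace X] [TopologicalSpace Y]
    {U : Set (X × Y)} (hU : IsOpen U) {K : Set Y} (hK : IsCompact K) :
    IsOpen {x | K ⊆ {y | (x, y) ∈ U}} :=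
  isOpen_iff_eventually.2 fun _ hx =>
    hK.eventually_forall_of_forall_eventually fun _ hy => hU.mem_nhds (hx hy)

lemma isOpen_setOf_mem_interior_queryCircle (R : ℝ) :
    IsOpen {z : (ℝ × ℝ) × (ℝ × ℝ) | z.2 ∈ (queryCircle R z.1).interior} :=
  have hφ : Continuous fun z : (ℝ × ℝ) × (ℝ × ℝ) => (queryCircle R z.1).φ :=
    continuous_fst.comp continuous_fst
  isOpen_lt (continuous_polarDist (by fun_prop) (by fun_prop) hφ
      ((continuous_queryCircle_r R).comp continuous_fst))
    ((continuous_queryCircle_rad R).comp continuous_fst)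

lemma measurableSet_straddles (R : ℝ) (c : Cell) :
    MeasurableSet {p | c.Straddles (queryCircle R p)} :=
  have hU := isOpen_setOf_mem_interior_queryCircle R
  have hK : IsCompact c.closedRegion := isCompact_Icc.prod isCompact_Icc
  (isOpen_setOf_inter_nonempty hU _).measurableSet.inter
    (isOpen_setOf_subset hU hK).measurableSet.compl

lemma measurableSet_preimage_finset {X κ : Type*} [MeasurableSpace X] [Countable κ]
    {F : X → Finset κ} (hF : ∀ c, MeasurableSet {x | c ∈ F x}) (s : Finset κ) :
    MeasurableSet (F ⁻¹' {s}) := by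
  have : F ⁻¹' {s} = ⋂ c, {x | c ∈ F x ↔ c ∈ s} := by
    ext x
    simp [Finset.ext_iff]
  rw [this]
  exact .iInter fun c => (hF c).iff (.const _)

lemma measurableSet_straddlingCells (α R : ℝ) (N : ℕ) (s : Finset (ℕ × ℕ)) :
    MeasurableSet ((fun p => straddlingCells α R N (queryCircle R p)) ⁻¹' {s}) := by
  refine measurableSet_preimage_finset (fun c => ?_) s
  simp only [straddlingCells, Finset.mem_filter]
  exact (MeasurableSet.const _).inter (measurableSet_straddles R _)

/-! ### Typical positions -/

lemma exists_measurableSet_forall_of_measure_not_le {Ω : Type*} [MeasurableSpace Ω]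
    {P : Measure Ω} [IsProbabilityMeasure P] {p : Ω → Prop} {ε : ℝ} (hε : 0 ≤ ε)
    (h : P {x | ¬ p x} ≤ ENNReal.ofReal ε) :
    ∃ A, MeasurableSet A ∧ ENNReal.ofReal (1 - ε) ≤ P A ∧ ∀ x ∈ A, p x := by
  refine ⟨(toMeasurable P {x | ¬ p x})ᶜ, (measurableSet_toMeasurable _ _).compl, ?_,
    fun x hx => not_not.1 fun hp => hx (subset_toMeasurable _ _ hp)⟩
  rw [prob_compl_eq_one_sub (measurableSet_toMeasurable _ _), measure_toMeasurable,
    ENNReal.ofReal_sub _ hε, ENNReal.ofReal_one]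
  exact tsub_le_tsub_left h 1

lemma choose_mul_pow_le (n K : ℕ) {q : ℝ} (hq : 0 ≤ q) :
    (n.choose K : ℝ) * q ^ K ≤ (Real.exp 1 * (n * q / K)) ^ K := by
  rcases K.eq_zero_or_pos with rfl | hK
  · simp
  have hfactorial : (K : ℝ) ^ K / K.factorial ≤ Real.exp 1 ^ K :=
    (Real.pow_div_factorial_le_exp K K.cast_nonneg K).trans_eq (Real.exp_one_pow K).symm
  have hK' : (K : ℝ) ^ K ≠ 0 := by positivity
  calc (n.choose K : ℝ) * q ^ K ≤ n ^ K / K.factorial * q ^ K := by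
        gcongr
        exact Nat.choose_le_pow_div K n
    _ = K ^ K / K.factorial * (n * q / K) ^ K := by
        rw [div_pow, mul_pow]
        field_simp
    _ ≤ Real.exp 1 ^ K * (n * q / K) ^ K := by gcongr
    _ = (Real.exp 1 * (n * q / K)) ^ K := (mul_pow _ _ _).symm

lemma two_mul_sq_le_two_pow {n N : ℕ} (hN : 0 < N) (hnN : n ≤ 4 * N ^ 2) :
    2 * n ^ 2 ≤ 2 ^ (216 * N) := by
  calc 2 * n ^ 2 ≤ 2 * (4 * (2 ^ N) ^ 2) ^ 2 := by
        gcongr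
        exact hnN.trans (by gcongr; exact Nat.lt_two_pow_self.le)
    _ = 2 ^ (5 + 4 * N) := by ring
    _ ≤ 2 ^ (216 * N) := Nat.pow_le_pow_right two_pos (by omega)

lemma mul_choose_mul_pow_le {n N : ℕ} (hn : 0 < n) (hnN : n ≤ 4 * N ^ 2) :
    (n : ℝ) * (n.choose (216 * N) * (9 / (N : ℝ)) ^ (216 * N)) ≤ 1 / (2 * n) := by
  have hN : 0 < N := Nat.pos_of_ne_zero (by rintro rfl; omega)
  have : (0 : ℝ) < n := by exact_mod_cast hn
  have : (0 : ℝ) < N := by exact_mod_cast hN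
  have hratio : Real.exp 1 * (n * (9 / (N : ℝ)) / (216 * N : ℕ)) ≤ 1 / 2 := by
    have hmean : n * (9 / (N : ℝ)) / (216 * N : ℕ) ≤ 1 / 6 := by
      have : (n : ℝ) ≤ 4 * N ^ 2 := by exact_mod_cast hnN
      push_cast
      field_simp
      linarith
    calc Real.exp 1 * (n * (9 / (N : ℝ)) / (216 * N : ℕ)) ≤ 3 * (1 / 6) := by
          gcongr
          exact Real.exp_one_lt_three.le
      _ = 1 / 2 := by norm_num
  have hpow : (2 : ℝ) * n ^ 2 ≤ 2 ^ (216 * N) := by exact_mod_cast two_mul_sq_le_two_pow hN hnN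
  calc (n : ℝ) * (n.choose (216 * N) * (9 / (N : ℝ)) ^ (216 * N)) ≤ n * (1 / 2) ^ (216 * N) := by
        gcongr
        exact (choose_mul_pow_le n _ (by positivity)).trans (by gcongr)
    _ = n / 2 ^ (216 * N) := by rw [one_div, inv_pow, div_eq_mul_inv]
    _ ≤ n / (2 * n ^ 2) := by gcongr
    _ = 1 / (2 * n) := by field_simp

section Typical

variable {α R : ℝ} {n : ℕ}

lemma ae_vertexLaw_forall_mem_root (hα : 0 < α) (hR : 0 < R) :
    ∀ᵐ x ∂vertexLaw n α R, ∀ v, x v ∈ (gridCell α R 1 (0, 0)).region := by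
  have := isProbabilityMeasure_positionLaw hα hR
  exact Filter.eventually_all.2 fun _ =>
    (Measure.tendsto_eval_ae_ae (μ := fun _ => positionLaw α R)).eventually (ae_mem_root hα hR)

lemma mem_grid_of_mem_root (hα : 0 < α) (hR : 0 < R) {N : ℕ} (hN : 0 < N) {c : ℕ × ℕ} {p : ℝ × ℝ}
    (hroot : p ∈ (gridCell α R 1 (0, 0)).region) (hp : p ∈ (gridCell α R N c).region) :
    c ∈ grid N := by
  rw [← one_mul N] at hp
  have h := gridCell_index_eq hα hR (region_subset_ancestor hα hR hN hp) hroot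
  obtain ⟨h₁, h₂⟩ := Prod.mk.inj h
  exact Finset.mem_product.2 ⟨Finset.mem_range.2 ((Nat.div_eq_zero_iff_lt hN).1 h₁),
    Finset.mem_range.2 ((Nat.div_eq_zero_iff_lt hN).1 h₂)⟩

lemma measure_not_separated_le (hα : 0 < α) (hR : 0 < R) {M : ℕ} (hn : 2 ≤ n)
    (hM : n ^ 4 ≤ M ^ 2) :
    vertexLaw n α R {x | ¬ Separated α R x M} ≤ ENNReal.ofReal (1 / (2 * n)) := by
  have := isProbabilityMeasure_positionLaw hα hR
  have hn' : (2 : ℝ) ≤ n := by exact_mod_cast hn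
  have hM' : (n : ℝ) ^ 4 ≤ (M : ℝ) ^ 2 := by exact_mod_cast hM
  have hM₀ : (0 : ℝ) < (M : ℝ) ^ 2 := lt_of_lt_of_le (by positivity) hM'
  have hMpos : 0 < M := Nat.pos_of_ne_zero (by rintro rfl; simp at hM₀)
  calc vertexLaw n α R {x | ¬ Separated α R x M}
      ≤ vertexLaw n α R {x | ∃ c ∈ grid M, ∃ v w, v ≠ w ∧
          x v ∈ (gridCell α R M c).region ∧ x w ∈ (gridCell α R M c).region} := by
        refine measure_mono_ae ?_
        filter_upwards [ae_vertexLaw_forall_mem_root hα hR] with x hx hsep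
        simp only [Separated, Set.Subsingleton, not_forall] at hsep
        obtain ⟨c, v, hv, w, hw, hvw⟩ := hsep
        exact ⟨c, mem_grid_of_mem_root hα hR hMpos (hx v) hv, v, w, hvw, hv, hw⟩
    _ ≤ (n : ENNReal) ^ 2 * ∑ _ ∈ grid M, ENNReal.ofReal (1 / (M : ℝ) ^ 2) ^ 2 := by
        have h := measure_pi_exists_collision_le (ι := Fin n) (μ := positionLaw α R) (grid M)
          fun c => (gridCell α R M c).region
        rwa [Fintype.card_fin, Finset.sum_congr rfl fun c hc => by
          rw [positionLaw_gridCell hα hR hc]] at h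
    _ = ENNReal.ofReal (n ^ 2 * ((M * M : ℕ) * (1 / (M : ℝ) ^ 2) ^ 2)) := by
        rw [Finset.sum_const, nsmul_eq_mul, grid, Finset.card_product, Finset.card_range,
          ENNReal.ofReal_mul (by positivity), ENNReal.ofReal_mul (by positivity),
          ENNReal.ofReal_pow (by positivity), ENNReal.ofReal_pow (by positivity),
          ENNReal.ofReal_natCast, ENNReal.ofReal_natCast]
    _ ≤ ENNReal.ofReal (1 / (2 * n)) := by
        refine ENNReal.ofReal_le_ofReal ?_
        calc (n : ℝ) ^ 2 * ((M * M : ℕ) * (1 / (M : ℝ) ^ 2) ^ 2) = n ^ 2 / M ^ 2 := by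
              push_cast
              field_simp
          _ ≤ (n : ℝ) ^ 2 / n ^ 4 := by gcongr
          _ = 1 / (n * n) := by field_simp
          _ ≤ 1 / (2 * n) := by gcongr

lemma positionLaw_biUnion_straddlingCells_le (hα : 0 < α) (hR : 0 < R) {N : ℕ} (hN : 0 < N)
    {Q : Circle} (hQ : Q.Central) :
    positionLaw α R (⋃ c ∈ straddlingCells α R N Q, (gridCell α R N c).region) ≤
      ENNReal.ofReal (9 / N) := by
  have hgrid : straddlingCells α R N Q ⊆ grid N := by
    classical
    simp only [straddlingCells]
    exact Finset.filter_subset _ _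
  calc _ ≤ ∑ _ ∈ straddlingCells α R N Q, ENNReal.ofReal (1 / (N : ℝ) ^ 2) :=
        (measure_biUnion_finset_le _ _).trans (Finset.sum_le_sum fun c hc =>
          (positionLaw_gridCell hα hR (hgrid hc)).le)
    _ ≤ (9 * N : ℕ) * ENNReal.ofReal (1 / (N : ℝ) ^ 2) := by
        rw [Finset.sum_const, nsmul_eq_mul]
        gcongr
        exact card_straddlingCells_le hα hR hQ hN
    _ = ENNReal.ofReal (9 / N) := by
        rw [← ENNReal.ofReal_natCast, ← ENNReal.ofReal_mul (by positivity)]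
        congr 1
        push_cast
        field_simp

lemma measure_exists_lt_card_straddlingVertices_le (hα : 0 < α) (hR : 0 < R) {N : ℕ}
    (hn : 0 < n) (hnN : n ≤ 4 * N ^ 2) :
    vertexLaw n α R
        {x | ∃ v, 216 * N < (straddlingVertices α R N (queryCircle R (x v)) x).card} ≤
      ENNReal.ofReal (1 / (2 * n)) := by
  have := isProbabilityMeasure_positionLaw hα hR
  have hN : 0 < N := Nat.pos_of_ne_zero (by rintro rfl; omega)
  have hmass : ∀ᵐ p ∂positionLaw α R, positionLaw α R
      (⋃ c ∈ straddlingCells α R N (queryCircle R p), (gridCell α R N c).region) ≤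
        ENNReal.ofReal (9 / N) := by
    filter_upwards [ae_mem_root hα hR] with p hp
    exact positionLaw_biUnion_straddlingCells_le hα hR hN
      (queryCircle_central_of_mem_root hα hR.le hp)
  refine (measure_mono ?_).trans ((measure_pi_exists_lt_card_le (ι := Fin n)
    (A := fun s : Finset (ℕ × ℕ) => ⋃ c ∈ s, (gridCell α R N c).region)
    (measurableSet_straddlingCells α R N) hmass (216 * N)).trans ?_)
  · rintro x ⟨v, hv⟩
    refine ⟨v, hv.trans_le (Finset.card_le_card fun w hw => ?_)⟩
    simpa only [straddlingVertices, Finset.mem_filter, Set.mem_iUnion₂, exists_prop] using hw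
  rw [Fintype.card_fin, ← ENNReal.ofReal_natCast n, ← ENNReal.ofReal_natCast,
    ← ENNReal.ofReal_pow (by positivity), ← ENNReal.ofReal_mul (by positivity),
    ← ENNReal.ofReal_mul (by positivity)]
  exact ENNReal.ofReal_le_ofReal (mul_choose_mul_pow_le hn hnN)

/-- The positions for which the generator is fast: all of them lie in the disk, the grid of side
length `M` separates them, and few of them lie in the cells of the grid of side length `N` that
some query circle straddles. -/
structure Typical (α R : ℝ) (N M : ℕ) (x : Fin n → ℝ × ℝ) : Prop where
  mem_root : ∀ v, x v ∈ (gridCell α R 1 (0, 0)).region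
  separated : Separated α R x M
  card_straddlingVertices_le :
    ∀ v, (straddlingVertices α R N (queryCircle R (x v)) x).card ≤ 216 * N

theorem measure_not_typical_le (hα : 0 < α) (hR : 0 < R) {N M : ℕ} (hn : 2 ≤ n)
    (hnN : n ≤ 4 * N ^ 2) (hM : n ^ 4 ≤ M ^ 2) :
    vertexLaw n α R {x | ¬ Typical α R N M x} ≤ ENNReal.ofReal (1 / n) := by
  calc _ ≤ vertexLaw n α R ({x | ¬ Separated α R x M} ∪
        {x | ∃ v, 216 * N < (straddlingVertices α R N (queryCircle R (x v)) x).card}) := by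
        refine measure_mono_ae ?_
        filter_upwards [ae_vertexLaw_forall_mem_root hα hR] with x hx htyp
        refine or_iff_not_imp_left.2 fun hsep => ?_
        by_contra hstr
        exact htyp ⟨hx, not_not.1 hsep, fun v => not_lt.1 fun hv => hstr ⟨v, hv⟩⟩
    _ ≤ ENNReal.ofReal (1 / (2 * n)) + ENNReal.ofReal (1 / (2 * n)) :=
        (measure_union_le _ _).trans (add_le_add (measure_not_separated_le hα hR hn hM)
          (measure_exists_lt_card_straddlingVertices_le hα hR (by omega) hnN))
    _ = ENNReal.ofReal (1 / n) := by
        rw [← ENNReal.ofReal_add (by positivity) (by positivity)]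
        congr 1
        ring

theorem exists_measurableSet_forall_typical (hα : 0 < α) (hR : 0 < R) (hn : 2 ≤ n) :
    ∃ A, MeasurableSet A ∧ ENNReal.ofReal (1 - 1 / n) ≤ vertexLaw n α R A ∧
      ∀ x ∈ A, Typical α R (2 ^ Nat.log 4 n) (2 ^ (4 * (Nat.log 4 n + 1))) x := by
  have := isProbabilityMeasure_vertexLaw hα hR n
  have hsq : ∀ e, (2 ^ e) ^ 2 = 4 ^ e := fun e => pow_right_comm 2 e 2
  have hlt : n < 4 ^ (Nat.log 4 n + 1) := Nat.lt_pow_succ_log_self (by norm_num) n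
  refine exists_measurableSet_forall_of_measure_not_le (by positivity)
    (measure_not_typical_le hα hR hn ?_ ?_)
  · rw [hsq, ← pow_succ']
    exact hlt.le
  · rw [hsq, mul_comm 4, pow_mul]
    exact Nat.pow_le_pow_left hlt.le 4

end Typical

/-! ### Sizes of the grids -/

lemma natLog_four_le_log {n : ℕ} (hn : 1 ≤ n) : (Nat.log 4 n : ℝ) ≤ Real.log n := by
  have hlog : 1 ≤ Real.log 4 := (Real.le_log_iff_exp_le four_pos).2
    (by linarith [Real.exp_one_lt_three])
  calc (Nat.log 4 n : ℝ) ≤ Real.logb 4 n := Real.natLog_le_logb n 4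
    _ ≤ Real.log n := div_le_self (Real.log_nonneg (by exact_mod_cast hn)) hlog

lemma two_pow_natLog_four_mul_le {n : ℕ} (hn : 1 ≤ n) :
    (2 : ℝ) ^ Nat.log 4 n * n ≤ (n : ℝ) ^ (3 / 2 : ℝ) := by
  have hn' : (0 : ℝ) < n := by exact_mod_cast hn
  have hpow : ((2 : ℝ) ^ Nat.log 4 n) ^ 2 ≤ n := by
    rw [pow_right_comm]
    exact_mod_cast Nat.pow_log_le_self 4 (by omega)
  rw [show (3 / 2 : ℝ) = 1 / 2 + 1 by norm_num, Real.rpow_add_one hn'.ne', ← Real.sqrt_eq_rpow]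
  gcongr
  exact Real.le_sqrt_of_sq_le hpow

lemma steps_le_log_mul {n : ℕ} (hn : 2 ≤ n) (m : ℕ) :
    ((4 * (Nat.log 4 n + 1) + 1 : ℕ) : ℝ) * (2 ^ Nat.log 4 n * n + m : ℕ) ≤
      12 * (((n : ℝ) ^ (3 / 2 : ℝ) + m) * Real.log n) := by
  have hlog : 0.69 < Real.log n := by
    have : Real.log 2 ≤ Real.log n := Real.log_le_log two_pos (by exact_mod_cast hn)
    linarith [Real.log_two_gt_d9]
  have hdepth : ((4 * (Nat.log 4 n + 1) + 1 : ℕ) : ℝ) ≤ 12 * Real.log n := by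
    push_cast
    linarith [natLog_four_le_log (by omega : 1 ≤ n)]
  have hsize : ((2 ^ Nat.log 4 n * n + m : ℕ) : ℝ) ≤ (n : ℝ) ^ (3 / 2 : ℝ) + m := by
    push_cast
    gcongr
    exact two_pow_natLog_four_mul_le (by omega)
  calc _ ≤ 12 * Real.log n * ((n : ℝ) ^ (3 / 2 : ℝ) + m) := by gcongr
    _ = _ := by ring

end RHG

end

/-- The bad event has probability at most `1/n`; outside of it the run terminates (no matter how
large a bound on the recursion depth is used), its output is the random hyperbolic graph of the
drawn positions, and the number of steps is bounded as stated. -/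
theorem theorem1 (cap : ℕ) (hcap : 1 ≤ cap) :
    ∃ (C : ℝ) (n₀ : ℕ), ∀ n : ℕ, n₀ ≤ n →
      ∀ (k α lo hi ε : ℝ) (rounds : ℕ), 0 < α → 0 ≤ lo → lo < hi → rounds ≤ n →
      ∀ R : ℝ, R = (RHG.targetRadius n k α ε rounds lo hi).1 →
      ∃ A : Set (Fin n → ℝ × ℝ), MeasurableSet A ∧
        ENNReal.ofReal (1 - 1 / (n : ℝ)) ≤ RHG.vertexLaw n α R A ∧
        ∀ x ∈ A, ∃ (E : List (Fin n × Fin n)) (t d : ℕ),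
          (∀ depth : ℕ, d ≤ depth →
            (RHG.generate cap n k α lo hi ε rounds x depth).Returns E t) ∧
          (∀ v w : Fin n, (v, w) ∈ E ↔ (RHG.hyperbolicGraph R x).Adj v w) ∧
          (t : ℝ) ≤ C * (((n : ℝ) ^ (3 / 2 : ℝ) +
            ((RHG.hyperbolicGraph R x).edgeSet.ncard : ℝ)) * Real.log n) := by
  refine ⟨12 * (1142 * (cap + 1) : ℕ), 2, ?_⟩
  intro n hn k α lo hi ε rounds hα hlo hlohi hrounds R hR
  have hRpos : 0 < R := hlo.trans_lt (hR ▸ RHG.lt_targetRadius n k α ε rounds hlohi)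
  obtain ⟨A, hA, hprob, htypical⟩ := RHG.exists_measurableSet_forall_typical hα hRpos hn
  refine ⟨A, hA, hprob, fun x hx => ?_⟩
  have hxt := htypical x hx
  obtain ⟨E, t, hrun, hadj, ht⟩ :=
    RHG.generate_returns hcap hα hrounds hRpos hR hxt.separated hxt.mem_root
  refine ⟨E, t, _, hrun, hadj, ?_⟩
  have hsteps := ht.trans (RHG.total_steps_le hα hRpos _ (by omega) hxt.mem_root
    hxt.card_straddlingVertices_le)
  have hgrids := RHG.steps_le_log_mul hn (RHG.hyperbolicGraph R x).edgeSet.ncard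
  calc (t : ℝ) ≤ (1142 * (cap + 1) : ℕ) * ((4 * (Nat.log 4 n + 1) + 1 : ℕ) *
        (2 ^ Nat.log 4 n * n + (RHG.hyperbolicGraph R x).edgeSet.ncard : ℕ)) := by
        rw [← mul_assoc]
        exact_mod_cast hsteps
    _ ≤ _ := by
        rw [mul_comm (12 : ℝ), mul_assoc]
        gcongr
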